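/- Let $a,q,\sigma_+,\sigma_-\in(0,\infty)$ and $\mu_+>0\ge\mu_-$. Put $$\theta_1^{\pm}=\frac{\sqrt{\mu_\pm^2+2q\sigma_\pm^2}+\mu_\pm}{\sigma_\pm^2},\quad \theta_2^{\pm}=\frac{\sqrt{\mu_\pm^2+2q\sigma_\pm^2}-\mu_\pm}{\sigma_\pm^2},\quad c_-=\frac{\theta_1^--\theta_1^+}{\theta_2^-+\theta_1^-},\quad c_+=\frac{\theta_2^+-\theta_2^-}{\theta_2^++\theta_1^+},$$ $$g^-(x)=e^{-\theta_1^+(x-a)}\mathbf 1_{\{x>a\}}+\big(c_-e^{\theta_2^-(x-a)}+(1-c_-)e^{-\theta_1^-(x-a)}\big)\mathbf 1_{\{x\le a\}},$$ $$g^+(x)=\big((1-c_+)e^{\theta_2^+(x-a)}+c_+e^{-\theta_1^+(x-a)}\big)\mathbf 1_{\{x>a\}}+e^{\theta_2^-(x-a)}\mathbf 1_{\{x\le a\}},$$ and $g(x)=g^+(x)g^-(0)-g^-(x)g^+(0)$ (a $C^1$ function). For $\beta>0$ let $\mathcal D_\zeta=\{(x,y)\in[0,\infty)^2:x+\beta\le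 y\}$, $\zeta(z_1,z_2)=\frac{z_2-z_1-\beta}{g(z_2)-g(z_1)}$ on $\mathcal D_\zeta$, and let $\mathcal M_\zeta$ be the set of global maximizers of $\zeta$ over $\mathcal D_\zeta$. Put $\psi(x,y)=\int_x^y\big(1-\frac{g'(s)}{g'(y)}\big)\,ds$, $\phi_0(x)=\psi(0,x)$ for $x\ge0$, and $$x_0=a+\frac{1}{\theta_2^++\theta_1^+}\ln\frac{(g^+(0)-c_+g^-(0))(\theta_1^+)^2}{(1-c_+)g^-(0)(\theta_2^+)^2},\quad \Theta=c_+(\theta_1^+)^2+(1-c_+)(\theta_2^+)^2,$$ $$a_2=\frac{\ln\frac{\theta_2^++\theta_1^-}{\theta_2^+-\theta_2^-}}{\theta_1^-+\theta_2^-},\quad a_3=\frac{1}{\theta_1^-+\theta_2^-}\ln\frac{(1-c_-c_+)(\theta_1^+)^2-(1-c_+)c_-(\theta_2^+)^2}{(1-c_-)\Theta}$$ (each used only where its logarithm is defined). Case (i) means that one of the following holds: $c_+>0$ and $a\ge a_2$; $c_+>0$ and $0<a_3\le a\le a_2$; $c_+\le0$, $a\ge a_3$ and $\Theta>0$. Case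 (ii) means that one of the following holds: $c_+>0$ and $0<a<a_2\wedge a_3$; $c_+\le0$ and $\Theta\le0$; $c_+\le0$, $0<a<a_3$ and $\Theta>0$. In Case (ii) let $a_7=\sup\{x>x_0:g'(x)\le g'(a)\}$, $(\hat g')_-^{-1}(v)=\inf\{y\in[0,a]:g'(y)\ge v\}$, let $(\hat g')_+^{-1}:[g'(x_0),g'(a_7)]\to[a,x_0]$ be the inverse of $g'|_{[a,x_0]}$, and $$x_3=\inf\Big\{x\in[x_0,a_7]:\int_0^{(\hat g')_+^{-1}(g'(x))}\Big(1-\frac{g'(s)}{g'(x)}\Big)ds\ge0\Big\},\quad x_4=\inf\Big\{x\in[x_0,a_7]:\int_{(\hat g')_-^{-1}(g'(x))}^x\Big(1-\frac{g'(s)}{g'(x)}\Big)ds\ge0\Big\},$$ $\omega_3(x)=\psi(0,x)$ for $x\in[0,(\hat g')_-^{-1}(g'(x_4))]\cup[x_4,\infty)$; $\omega_4(x)=\psi((\hat g')_+^{-1}(g'(x)),x)$ for $x\in[x_0,x_3)$ and $\omega_4(x)=\psi(0,x)$ for $x\in[x_3,\infty)$. Let $\omega_3^{-1}(\beta)$ and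 $\omega_4^{-1}(\beta)$ denote the preimages of $\beta$ in these domains, and put $$B_1=\{\beta>0:g'(\omega_3^{-1}(\beta))<g'(\omega_4^{-1}(\beta))\},\quad B_2=\{\beta>0:g'(\omega_3^{-1}(\beta))>g'(\omega_4^{-1}(\beta))\},\quad B_3=(\omega_4(x_3),\infty),$$ where $g'(\omega_4^{-1}(\beta))$ is read as $+\infty$ if $\beta$ is not a value of $\omega_4$ (so that such $\beta$ belong to $B_1$). Write $\overline B=(0,\infty)\setminus B$. Theorem. - In Case (i), $\phi_0$ is a bijection of $[0,\infty)$ onto itself and, for every $\beta>0$, $\mathcal M_\zeta=\{(0,\phi_0^{-1}(\beta))\}$. - In Case (ii), $g'$ maps $[a,x_0]$ bijectively onto $[g'(x_0),g'(a_7)]$, $\omega_4$ maps $[x_0,\infty)$ bijectively onto $[\omega_4(x_0),\infty)$, and for $\beta>0$ the set $\omega_3^{-1}(\beta)$ is a singleton if $\beta\ne\omega_3(x_4)$, while if $\beta=\omega_3(x_4)$ it equals $\{(\hat g')_-^{-1}(g'(x_4)),x_4\}$ and $g'$ takes the same value at these two points. For every $\beta>0$, with $\hat W=\{(0,y):y\in\omega_3^{-1}(\beta)\}$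 and $\tilde w=\big((\hat g')_+^{-1}(g'(\omega_4^{-1}(\beta))),\omega_4^{-1}(\beta)\big)$, $$\mathcal M_\zeta=\begin{cases}\hat W,&\beta\in B_1\cup B_3,\\ \{\tilde w\},&\beta\in B_2\cap\overline{B_3},\\ \hat W\cup\{\tilde w\},&\beta\in\overline{B_1\cup B_2\cup B_3},\end{cases}$$ where in the last two cases $\beta$ is a value of $\omega_4$, so that $\tilde w$ is defined. Moreover $B_2\cap B_3=\emptyset$. -/

import Mathlib

noncomputable section

namespace ImpulseDividend

open Set MeasureTheory

/-- The parameters of the diffusion `dX = (σ₊ 1_{X>a} + σ₋ 1_{X≤a}) dB + (μ₊ 1_{X>a} + μ₋ 1_{X≤a}) dt`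
together with the discount rate `q`. -/
structure Params where
  a : ℝ
  μp : ℝ
  μm : ℝ
  σp : ℝ
  σm : ℝ
  q : ℝ

namespace Params

variable (P : Params)

/-- `θ₁⁺` -/
def θ1p : ℝ := (√(P.μp ^ 2 + 2 * P.q * P.σp ^ 2) + P.μp) / P.σp ^ 2

/-- `θ₂⁺` -/
def θ2p : ℝ := (√(P.μp ^ 2 + 2 * P.q * P.σp ^ 2) - P.μp) / P.σp ^ 2

/-- `θ₁⁻` -/
def θ1m : ℝ := (√(P.μm ^ 2 + 2 * P.q * P.σm ^ 2) + P.μm) / P.σm ^ 2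

/-- `θ₂⁻` -/
def θ2m : ℝ := (√(P.μm ^ 2 + 2 * P.q * P.σm ^ 2) - P.μm) / P.σm ^ 2

/-- `c₋` -/
def cm : ℝ := (P.θ1m - P.θ1p) / (P.θ2m + P.θ1m)

/-- `c₊` -/
def cp : ℝ := (P.θ2p - P.θ2m) / (P.θ2p + P.θ1p)

/-- `g⁻` -/
def gm (x : ℝ) : ℝ :=
  if P.a < x then Real.exp (-P.θ1p * (x - P.a))
  else P.cm * Real.exp (P.θ2m * (x - P.a)) + (1 - P.cm) * Real.exp (-P.θ1m * (x - P.a))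

/-- `g⁺` -/
def gp (x : ℝ) : ℝ :=
  if P.a < x then
    (1 - P.cp) * Real.exp (P.θ2p * (x - P.a)) + P.cp * Real.exp (-P.θ1p * (x - P.a))
  else Real.exp (P.θ2m * (x - P.a))

/-- `g(x) = g⁺(x) g⁻(0) - g⁻(x) g⁺(0)` -/
def g (x : ℝ) : ℝ := P.gp x * P.gm 0 - P.gm x * P.gp 0

/-- `g'` -/
def g' (x : ℝ) : ℝ := deriv P.g x

/-- The domain `D_ζ`, for the transaction cost `β`. -/
def Dζ (β : ℝ) : Set (ℝ × ℝ) := {z | 0 ≤ z.1 ∧ 0 ≤ z.2 ∧ z.1 + β ≤ z.2}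

/-- `ζ(z₁, z₂)`, for the transaction cost `β`. -/
def ζ (β : ℝ) (z : ℝ × ℝ) : ℝ := (z.2 - z.1 - β) / (P.g z.2 - P.g z.1)

/-- `M_ζ`, the set of global maximizers of `ζ` over `D_ζ`. -/
def Mζ (β : ℝ) : Set (ℝ × ℝ) := {z | z ∈ Dζ β ∧ ∀ w ∈ Dζ β, P.ζ β w ≤ P.ζ β z}

/-- `ψ(x, y) = ∫_x^y (1 - g'(s) / g'(y)) ds` -/
def ψ (x y : ℝ) : ℝ := ∫ s in x..y, (1 - P.g' s / P.g' y)

def x0 : ℝ :=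
  Real.log (((P.gp 0 - P.cp * P.gm 0) * P.θ1p ^ 2) / ((1 - P.cp) * P.gm 0 * P.θ2p ^ 2)) /
    (P.θ2p + P.θ1p) + P.a

def Θ : ℝ := P.cp * P.θ1p ^ 2 + (1 - P.cp) * P.θ2p ^ 2

def a2 : ℝ := Real.log ((P.θ2p + P.θ1m) / (P.θ2p - P.θ2m)) / (P.θ1m + P.θ2m)

def a3 : ℝ :=
  Real.log (((1 - P.cm * P.cp) * P.θ1p ^ 2 - (1 - P.cp) * P.cm * P.θ2p ^ 2) /
    ((1 - P.cm) * P.Θ)) / (P.θ1m + P.θ2m)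

/-- Case (i) for `μ₊ > 0`, `μ₋ ≤ 0`. -/
def CaseI : Prop :=
  (0 < P.cp ∧ P.a2 ≤ P.a) ∨
  (0 < P.cp ∧ 0 < P.a3 ∧ P.a3 ≤ P.a ∧ P.a ≤ P.a2) ∨
  (P.cp ≤ 0 ∧ P.a3 ≤ P.a ∧ 0 < P.Θ)

/-- Case (ii) for `μ₊ > 0`, `μ₋ ≤ 0`. -/
def CaseII : Prop :=
  (0 < P.cp ∧ 0 < P.a ∧ P.a < min P.a2 P.a3) ∨
  (P.cp ≤ 0 ∧ P.Θ ≤ 0) ∨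
  (P.cp ≤ 0 ∧ 0 < P.a ∧ P.a < P.a3 ∧ 0 < P.Θ)

/-- `φ₀(x) = ψ(0, x)`, `x ∈ [0, ∞)`. -/
def φ0 (x : ℝ) : ℝ := P.ψ 0 x

/-- `φ₀⁻¹`, the inverse of `φ₀` on `[0, ∞)`. -/
def φ0Inv (β : ℝ) : ℝ := Function.invFunOn P.φ0 (Ici 0) β

def a7 : ℝ := sSup {x | P.x0 < x ∧ P.g' x ≤ P.g' P.a}

/-- `(ĝ')₋⁻¹`, as a function of the value `v` of the derivative:
`inf {y ∈ [0, a] : g'(y) ≥ v}`. -/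
def gInvMinus (v : ℝ) : ℝ := sInf {y | y ∈ Icc 0 P.a ∧ v ≤ P.g' y}

/-- `(ĝ')₊⁻¹`, the inverse of `g'` restricted to `[a, x₀]`. -/
def gInvPlus (v : ℝ) : ℝ := Function.invFunOn P.g' (Icc P.a P.x0) v

def x3 : ℝ :=
  sInf {x | x ∈ Icc P.x0 P.a7 ∧ 0 ≤ ∫ s in (0 : ℝ)..P.gInvPlus (P.g' x), (1 - P.g' s / P.g' x)}

def x4 : ℝ :=
  sInf {x | x ∈ Icc P.x0 P.a7 ∧ 0 ≤ ∫ s in P.gInvMinus (P.g' x)..x, (1 - P.g' s / P.g' x)}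

/-- The domain of `ω₃`. -/
def ω3Dom : Set ℝ := Icc 0 (P.gInvMinus (P.g' P.x4)) ∪ Ici P.x4

def ω3 (x : ℝ) : ℝ := ∫ s in (0 : ℝ)..x, (1 - P.g' s / P.g' x)

/-- `ω₄`, considered on `[x₀, ∞)`. -/
def ω4 (x : ℝ) : ℝ :=
  if x < P.x3 then ∫ s in P.gInvPlus (P.g' x)..x, (1 - P.g' s / P.g' x)
  else ∫ s in (0 : ℝ)..x, (1 - P.g' s / P.g' x)

/-- `ω₃⁻¹(β)`, as the set of preimages of `β` in the domain of `ω₃`; it is a one-point set except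
for one value of `β`, where it has two points. -/
def ω3Inv (β : ℝ) : Set ℝ := {x | x ∈ P.ω3Dom ∧ P.ω3 x = β}

/-- `ω₄⁻¹`, the inverse of `ω₄` on `[x₀, ∞)`; meaningful for `β ∈ ω₄([x₀, ∞))`. -/
def ω4Inv (β : ℝ) : ℝ := Function.invFunOn P.ω4 (Ici P.x0) β

/-- `B₁ = {β > 0 : g'(ω₃⁻¹(β)) < g'(ω₄⁻¹(β))}`, where `g'(ω₄⁻¹(β))` is read as `+∞` if `β` is not
a value of `ω₄` on `[x₀, ∞)`. -/
def B1 : Set ℝ :=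
  {β | 0 < β ∧ ∃ u ∈ P.ω3Inv β, β ∉ P.ω4 '' Ici P.x0 ∨ P.g' u < P.g' (P.ω4Inv β)}

/-- `B₂ = {β > 0 : g'(ω₃⁻¹(β)) > g'(ω₄⁻¹(β))}`, with the same convention. -/
def B2 : Set ℝ :=
  {β | 0 < β ∧ ∃ u ∈ P.ω3Inv β, β ∈ P.ω4 '' Ici P.x0 ∧ P.g' (P.ω4Inv β) < P.g' u}

def B3 : Set ℝ := Ioi (P.ω4 P.x3)

/-- The pairs `(ŵ₁, ŵ₂) = (0, ω₃⁻¹(β))`: one or two points. -/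
def wHat (β : ℝ) : Set (ℝ × ℝ) := (fun y => ((0 : ℝ), y)) '' P.ω3Inv β

/-- The pair `(w̃₁, w̃₂)`. -/
def wTilde (β : ℝ) : ℝ × ℝ := (P.gInvPlus (P.g' (P.ω4Inv β)), P.ω4Inv β)

end Params

end ImpulseDividend

end

/-!
Maximizing a quotient `N / D` amounts to finding a level `v` for which the maximum of `v * N - D`
is zero (Dinkelbach). Here `ζ` is maximal at `(x, y)` with value `1 / v` exactly when the largest
increment of `s ↦ s - g s / v` is `β` and is attained on `[x, y]`, so `M_ζ` is determined by the
optimal intervals of the single function `s - g s / v` and by the level at which their gain is `β`.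

In Case (i) `g'` increases on `[0, ∞)`, so `s - g s / v` rises up to the point where `g' = v` and
falls afterwards: optimal intervals are `[0, y]` with gain `φ₀ y`, and `φ₀` is strictly increasing.

In Case (ii) `g'` increases on `[0, a]`, decreases on `[a, x₀]` and increases again, so
`s - g s / v` has at most two local maxima and one interior local minimum. An optimal interval
starts at `0` or at a point of `[a, x₀]` and ends in `[0, a]` or in `[x₀, ∞)`. The functions `ω₃`
and `ω₄` are the best gains from the start `0` and up to an end in `[x₀, ∞)` respectively. As
functions of the level both are increasing, so the smaller of the two levels at which they reach
`β` is the optimal one.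
-/

namespace ImpulseDividend

open Set Filter Topology MeasureTheory

section Auxiliary

lemma hasDerivAt_ite_lt {E : Type*} [NormedAddCommGroup E] [NormedSpace ℝ E] {c : ℝ}
    {f k f' k' : ℝ → E} (hf : ∀ x, HasDerivAt f (f' x) x) (hk : ∀ x, HasDerivAt k (k' x) x)
    (hfk : f c = k c) (hfk' : f' c = k' c) (x : ℝ) :
    HasDerivAt (fun y => if c < y then f y else k y) (if c < x then f' x else k' x) x := by
  rcases lt_trichotomy c x with h | rfl | h
  · rw [if_pos h]
    refine (hf x).congr_of_eventuallyEq ?_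
    filter_upwards [lt_mem_nhds h] with y hy
    rw [if_pos hy]
  · rw [if_neg (lt_irrefl _), ← hasDerivWithinAt_univ, ← Iic_union_Ici (a := c)]
    refine HasDerivWithinAt.union ?_ ?_
    · exact (hk c).hasDerivWithinAt.congr (fun y hy => if_neg (not_lt.2 hy))
        (if_neg (lt_irrefl _))
    · rw [← hfk']
      refine (hf c).hasDerivWithinAt.congr (fun y hy => ?_) (by rw [if_neg (lt_irrefl _), hfk])
      rcases (mem_Ici.1 hy).eq_or_lt with rfl | hlt
      · rw [if_neg (lt_irrefl _), hfk]
      · rw [if_pos hlt]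
  · rw [if_neg h.not_gt]
    refine (hk x).congr_of_eventuallyEq ?_
    filter_upwards [gt_mem_nhds h] with y hy
    rw [if_neg (not_lt.2 hy.le)]

lemma bijOn_Ici_of_strictMonoOn {α δ : Type*} [ConditionallyCompleteLinearOrder α]
    [TopologicalSpace α] [OrderTopology α] [DenselyOrdered α] [LinearOrder δ] [TopologicalSpace δ]
    [OrderClosedTopology δ] {f : α → δ} {b : α} (hc : ContinuousOn f (Ici b))
    (hm : StrictMonoOn f (Ici b)) (hf : Tendsto f atTop atTop) :
    BijOn f (Ici b) (Ici (f b)) := by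
  rw [← hc.image_Ici_of_monotoneOn hm.monotoneOn hf]
  exact hm.injOn.bijOn_image

section SInf

variable {α δ : Type*} [ConditionallyCompleteLinearOrder α] {F : α → δ} {b c : α} {v : δ}

lemma apply_lt_of_lt_sInf_le_apply [LinearOrder δ] {x : α} (hbx : b ≤ x) (hxc : x ≤ c)
    (hx : x < sInf {x | x ∈ Icc b c ∧ v ≤ F x}) : F x < v :=
  not_le.1 fun h => notMem_of_lt_csInf hx ⟨b, fun _ hy => hy.1.1⟩ ⟨⟨hbx, hxc⟩, h⟩

variable [TopologicalSpace α] [OrderTopology α] [LinearOrder δ] [TopologicalSpace δ]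
  [OrderClosedTopology δ]

lemma sInf_le_apply_mem (hbc : b ≤ c) (hF : ContinuousOn F (Icc b c))
    (hv : v ≤ F c) :
    sInf {x | x ∈ Icc b c ∧ v ≤ F x} ∈ Icc b c ∧ v ≤ F (sInf {x | x ∈ Icc b c ∧ v ≤ F x}) :=
  (hF.preimage_isClosed_of_isClosed isClosed_Icc isClosed_Ici).csInf_mem
    ⟨c, right_mem_Icc.2 hbc, hv⟩ ⟨b, fun _ hx => hx.1.1⟩

lemma apply_sInf_le_apply_eq [DenselyOrdered α] (hbc : b ≤ c) (hF : ContinuousOn F (Icc b c))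
    (hv : v ≤ F c)
    (hb : b < sInf {x | x ∈ Icc b c ∧ v ≤ F x}) :
    F (sInf {x | x ∈ Icc b c ∧ v ≤ F x}) = v := by
  obtain ⟨⟨hbm, hmc⟩, hvm⟩ := sInf_le_apply_mem hbc hF hv
  set m := sInf {x | x ∈ Icc b c ∧ v ≤ F x}
  refine le_antisymm ?_ hvm
  have hcont : ContinuousWithinAt F (Ico b m) m :=
    (hF m ⟨hbm, hmc⟩).mono (Ico_subset_Icc_self.trans (Icc_subset_Icc_right hmc))
  have hm : m ∈ closure (Ico b m) := by
    rw [closure_Ico hb.ne]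
    exact right_mem_Icc.2 hbm
  exact hcont.closure_le hm continuousWithinAt_const fun x hx =>
    (apply_lt_of_lt_sInf_le_apply hx.1 (hx.2.le.trans hmc) hx.2).le

end SInf

lemma isMaxOn_div_iff {α K : Type*} [Field K] [LinearOrder K] [IsStrictOrderedRing K]
    {N D : α → K} {s : Set α} {c : K} (hD : ∀ z ∈ s, 0 < D z)
    (hle : ∀ z ∈ s, N z ≤ c * D z) (heq : ∃ z ∈ s, N z = c * D z) {z : α} (hz : z ∈ s) :
    IsMaxOn (fun z => N z / D z) s z ↔ N z = c * D z := by
  have hdiv {w : α} (hw : w ∈ s) : N w / D w ≤ c := (div_le_iff₀ (hD w hw)).2 (hle w hw)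
  refine ⟨fun hmax => (hle z hz).antisymm ?_, fun hzc w hw => ?_⟩
  · obtain ⟨w, hw, hwc⟩ := heq
    have hwz : N w / D w ≤ N z / D z := hmax hw
    rwa [hwc, mul_div_cancel_right₀ _ (hD w hw).ne', le_div_iff₀ (hD z hz)] at hwz
  · have hz' : N z / D z = c := by rw [hzc, mul_div_cancel_right₀ _ (hD z hz).ne']
    exact (hdiv hw).trans_eq hz'.symm

lemma log_div_div_le_iff {N D c s x : ℝ} (hs : 0 < s) (hc : c < 1) (hD : 0 < D)
    (hN : c * D < N) :
    Real.log ((N - c * D) / ((1 - c) * D)) / s ≤ x ↔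
      N ≤ (c + (1 - c) * Real.exp (s * x)) * D := by
  have hcD : 0 < (1 - c) * D := mul_pos (sub_pos.2 hc) hD
  rw [div_le_iff₀ hs, Real.log_le_iff_le_exp (div_pos (sub_pos.2 hN) hcD), div_le_iff₀ hcD,
    mul_comm x, sub_le_iff_le_add]
  ring_nf

/-- The general solution `A e^{s(x-c)} - B e^{-t(x-c)}` of the generator equation on one side of
the switching point. With this sign of `B`, monotonicity and positivity compare `A` with `B`. -/
noncomputable def expPair (A B s t c x : ℝ) : ℝ :=
  A * Real.exp (s * (x - c)) - B * Real.exp (-(t * (x - c)))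

variable {A B s t b c x : ℝ}

lemma expPair_self (A B s t c : ℝ) : expPair A B s t c c = A - B := by
  simp [expPair]

lemma hasDerivAt_expPair (A B s t c x : ℝ) :
    HasDerivAt (expPair A B s t c) (expPair (A * s) (-(B * t)) s t c x) x := by
  have hexp (r : ℝ) : HasDerivAt (fun x => Real.exp (r * (x - c)))
      (Real.exp (r * (x - c)) * (r * 1)) x :=
    (((hasDerivAt_id x).sub_const c).const_mul r).exp
  have hd := ((hexp s).const_mul A).sub ((hexp (-t)).const_mul B)
  simp only [neg_mul] at hd
  exact hd.congr_deriv (by rw [expPair]; ring)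

lemma continuous_expPair (A B s t c : ℝ) : Continuous (expPair A B s t c) :=
  continuous_iff_continuousAt.2 fun x => (hasDerivAt_expPair A B s t c x).continuousAt

lemma expPair_eq_mul (A B s t c x : ℝ) : expPair A B s t c x =
    (A * Real.exp ((s + t) * (x - c)) - B) * Real.exp (-(t * (x - c))) := by
  rw [expPair, sub_mul, mul_assoc A, ← Real.exp_add]
  ring_nf

lemma expPair_pos_iff : 0 < expPair A B s t c x ↔ B < A * Real.exp ((s + t) * (x - c)) := by
  rw [expPair_eq_mul, mul_pos_iff_of_pos_right (Real.exp_pos _), sub_pos]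

lemma expPair_neg_iff : expPair A B s t c x < 0 ↔ A * Real.exp ((s + t) * (x - c)) < B := by
  rw [expPair_eq_mul, ← neg_pos, ← neg_mul, mul_pos_iff_of_pos_right (Real.exp_pos _), neg_sub,
    sub_pos]

lemma expPair_pos_of_le (hA : 0 ≤ A) (hst : 0 ≤ s + t) (hBA : B < A) (hx : c ≤ x) :
    0 < expPair A B s t c x :=
  expPair_pos_iff.2 (hBA.trans_le (le_mul_of_one_le_right hA
    (Real.one_le_exp (mul_nonneg hst (sub_nonneg.2 hx)))))

lemma mul_exp_lt_mul_exp (hA : 0 < A) (hs : 0 < s) (hbx : b < x) :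
    A * Real.exp (s * (b - c)) < A * Real.exp (s * (x - c)) :=
  mul_lt_mul_of_pos_left
    (Real.exp_lt_exp.2 (mul_lt_mul_of_pos_left (sub_lt_sub_right hbx c) hs)) hA

lemma strictMonoOn_expPair (hA : 0 < A * s) (hst : 0 < s + t)
    (hb : -(B * t) ≤ A * s * Real.exp ((s + t) * (b - c))) :
    StrictMonoOn (expPair A B s t c) (Ici b) := by
  refine strictMonoOn_of_deriv_pos (convex_Ici b) (continuous_expPair A B s t c).continuousOn
    fun x hx => ?_
  rw [interior_Ici] at hx
  rw [(hasDerivAt_expPair A B s t c x).deriv]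
  exact expPair_pos_iff.2 (hb.trans_lt (mul_exp_lt_mul_exp hA hst hx))

lemma strictAntiOn_expPair (hA : 0 < A * s) (hst : 0 < s + t)
    (hb : A * s * Real.exp ((s + t) * (b - c)) ≤ -(B * t)) :
    StrictAntiOn (expPair A B s t c) (Iic b) := by
  refine strictAntiOn_of_deriv_neg (convex_Iic b) (continuous_expPair A B s t c).continuousOn
    fun x hx => ?_
  rw [interior_Iic] at hx
  rw [(hasDerivAt_expPair A B s t c x).deriv]
  exact expPair_neg_iff.2 ((mul_exp_lt_mul_exp hA hst hx).trans_le hb)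

lemma tendsto_expPair_atTop (hA : 0 < A) (hs : 0 < s) (ht : 0 < t) :
    Tendsto (expPair A B s t c) atTop atTop := by
  have hlin {r : ℝ} (hr : 0 < r) : Tendsto (fun x => r * (x - c)) atTop atTop :=
    (tendsto_atTop_add_const_right _ (-c) tendsto_id).const_mul_atTop hr
  have hup : Tendsto (fun x => A * Real.exp (s * (x - c))) atTop atTop :=
    (Real.tendsto_exp_atTop.comp (hlin hs)).const_mul_atTop hA
  have hdown : Tendsto (fun x => -(B * Real.exp (-(t * (x - c))))) atTop (𝓝 (-(B * 0))) :=
    ((Real.tendsto_exp_neg_atTop_nhds_zero.comp (hlin ht)).const_mul B).neg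
  exact (hup.atTop_add hdown).congr fun x => (sub_eq_add_neg _ _).symm

end Auxiliary

section Surplus

/-- The primitive `x - f x / v` of the integrand `1 - f' / v` of `ψ`, the level `v` standing for
the value of `f'` at the upper endpoint. -/
noncomputable def surplus (f : ℝ → ℝ) (v x : ℝ) : ℝ := x - f x / v

/-- The increment of `surplus` over `[c, x]` at the level `f' x` of the upper endpoint. For `f = g`
this is `ψ(c, x)`. -/
noncomputable def levelGain (f : ℝ → ℝ) (c x : ℝ) : ℝ :=
  surplus f (deriv f x) x - surplus f (deriv f x) c

variable {f : ℝ → ℝ} {v w x y z : ℝ} {s : Set ℝ}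

lemma surplus_sub_surplus (f : ℝ → ℝ) (v x y : ℝ) :
    surplus f v y - surplus f v x = y - x - (f y - f x) / v := by
  rw [surplus, surplus, sub_div]
  ring

lemma levelGain_self (f : ℝ → ℝ) (c : ℝ) : levelGain f c c = 0 := sub_self _

lemma hasDerivAt_surplus (hf : DifferentiableAt ℝ f x) (v : ℝ) :
    HasDerivAt (surplus f v) (1 - deriv f x / v) x :=
  (hasDerivAt_id x).sub (hf.hasDerivAt.div_const v)

lemma continuous_surplus (hf : Continuous f) (v : ℝ) : Continuous (surplus f v) :=
  continuous_id.sub (hf.div_const v)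

lemma integral_one_sub_deriv_div (hf : ContDiff ℝ 1 f) (v x y : ℝ) :
    ∫ s in x..y, (1 - deriv f s / v) = surplus f v y - surplus f v x := by
  have hcont : Continuous (deriv f) := hf.continuous_deriv_one
  exact intervalIntegral.integral_eq_sub_of_hasDerivAt
    (fun s _ => hasDerivAt_surplus (hf.differentiable_one s) v)
    ((continuous_const.sub (hcont.div_const v)).intervalIntegrable x y)

lemma surplus_lt_of_deriv_lt (hf : Differentiable ℝ f) (hv : 0 < v) (hxy : x < y)
    (hlt : ∀ s ∈ Ioo x y, deriv f s < v) : surplus f v x < surplus f v y := by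
  refine strictMonoOn_of_deriv_pos (convex_Icc x y)
    (continuous_surplus hf.continuous v).continuousOn (fun s hs => ?_)
    (left_mem_Icc.2 hxy.le) (right_mem_Icc.2 hxy.le) hxy
  rw [interior_Icc] at hs
  rw [(hasDerivAt_surplus (hf s) v).deriv, sub_pos, div_lt_one hv]
  exact hlt s hs

lemma surplus_lt_of_lt_deriv (hf : Differentiable ℝ f) (hv : 0 < v) (hxy : x < y)
    (hlt : ∀ s ∈ Ioo x y, v < deriv f s) : surplus f v y < surplus f v x := by
  refine strictAntiOn_of_deriv_neg (convex_Icc x y)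
    (continuous_surplus hf.continuous v).continuousOn (fun s hs => ?_)
    (left_mem_Icc.2 hxy.le) (right_mem_Icc.2 hxy.le) hxy
  rw [interior_Icc] at hs
  rw [(hasDerivAt_surplus (hf s) v).deriv, sub_neg, one_lt_div hv]
  exact hlt s hs

lemma min_surplus_lt_surplus (hf : Differentiable ℝ f) (hv : 0 < v)
    (hm : StrictMonoOn (deriv f) (Icc x z)) (hxy : x < y) (hyz : y < z) :
    min (surplus f v x) (surplus f v z) < surplus f v y := by
  have hy : y ∈ Icc x z := ⟨hxy.le, hyz.le⟩
  rcases le_or_gt (deriv f y) v with hle | hgt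
  · exact min_lt_of_left_lt (surplus_lt_of_deriv_lt hf hv hxy fun s hs =>
      (hm ⟨hs.1.le, hs.2.le.trans hyz.le⟩ hy hs.2).trans_le hle)
  · exact min_lt_of_right_lt (surplus_lt_of_lt_deriv hf hv hyz fun s hs =>
      hgt.trans (hm hy ⟨hxy.le.trans hs.1.le, hs.2.le⟩ hs.1))

lemma surplus_lt_max_surplus (hf : Differentiable ℝ f) (hv : 0 < v)
    (hm : StrictAntiOn (deriv f) (Icc x z)) (hxy : x < y) (hyz : y < z) :
    surplus f v y < max (surplus f v x) (surplus f v z) := by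
  have hy : y ∈ Icc x z := ⟨hxy.le, hyz.le⟩
  rcases le_or_gt (deriv f y) v with hle | hgt
  · exact lt_max_of_lt_right (surplus_lt_of_deriv_lt hf hv hyz fun s hs =>
      (hm hy ⟨hxy.le.trans hs.1.le, hs.2.le⟩ hs.1).trans_le hle)
  · exact lt_max_of_lt_left (surplus_lt_of_lt_deriv hf hv hxy fun s hs =>
      hgt.trans (hm ⟨hs.1.le, hs.2.le.trans hyz.le⟩ hy hs.2))

lemma surplus_lt_surplus_of_strictMonoOn (hf : Differentiable ℝ f) (hs : s.OrdConnected)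
    (hm : StrictMonoOn (deriv f) s) (hx : x ∈ s) (hy : y ∈ s) (hpos : 0 < deriv f x)
    (hne : y ≠ x) : surplus f (deriv f x) y < surplus f (deriv f x) x := by
  rcases hne.lt_or_gt with hlt | hlt
  · exact surplus_lt_of_deriv_lt hf hpos hlt fun s hs' =>
      hm (hs.out hy hx (Ioo_subset_Icc_self hs')) hx hs'.2
  · exact surplus_lt_of_lt_deriv hf hpos hlt fun s hs' =>
      hm hx (hs.out hx hy (Ioo_subset_Icc_self hs')) hs'.1

lemma surplus_le_surplus_of_strictMonoOn (hf : Differentiable ℝ f) (hs : s.OrdConnected)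
    (hm : StrictMonoOn (deriv f) s) (hx : x ∈ s) (hy : y ∈ s) (hpos : 0 < deriv f x) :
    surplus f (deriv f x) y ≤ surplus f (deriv f x) x := by
  rcases eq_or_ne y x with rfl | hne
  · exact le_rfl
  · exact (surplus_lt_surplus_of_strictMonoOn hf hs hm hx hy hpos hne).le

lemma surplus_lt_surplus_of_strictAntiOn (hf : Differentiable ℝ f) (hs : s.OrdConnected)
    (hm : StrictAntiOn (deriv f) s) (hx : x ∈ s) (hy : y ∈ s) (hpos : 0 < deriv f x)
    (hne : y ≠ x) : surplus f (deriv f x) x < surplus f (deriv f x) y := by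
  rcases hne.lt_or_gt with hlt | hlt
  · exact surplus_lt_of_lt_deriv hf hpos hlt fun s hs' =>
      hm (hs.out hy hx (Ioo_subset_Icc_self hs')) hx hs'.2
  · exact surplus_lt_of_deriv_lt hf hpos hlt fun s hs' =>
      hm hx (hs.out hx hy (Ioo_subset_Icc_self hs')) hs'.1

lemma surplus_le_surplus_of_strictAntiOn (hf : Differentiable ℝ f) (hs : s.OrdConnected)
    (hm : StrictAntiOn (deriv f) s) (hx : x ∈ s) (hy : y ∈ s) (hpos : 0 < deriv f x) :
    surplus f (deriv f x) x ≤ surplus f (deriv f x) y := by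
  rcases eq_or_ne y x with rfl | hne
  · exact le_rfl
  · exact (surplus_lt_surplus_of_strictAntiOn hf hs hm hx hy hpos hne).le

lemma surplus_sub_surplus_lt_of_lt (hf : StrictMono f) (hv : 0 < v) (hvw : v < w)
    (hxy : x < y) : surplus f v y - surplus f v x < surplus f w y - surplus f w x := by
  rw [surplus_sub_surplus, surplus_sub_surplus]
  exact sub_lt_sub_left (div_lt_div_of_pos_left (sub_pos.2 (hf hxy)) hv hvw) _

lemma surplus_sub_surplus_le_of_le (hf : Monotone f) (hv : 0 < v) (hvw : v ≤ w)
    (hxy : x ≤ y) : surplus f v y - surplus f v x ≤ surplus f w y - surplus f w x := by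
  rw [surplus_sub_surplus, surplus_sub_surplus]
  exact sub_le_sub_left (div_le_div_of_nonneg_left (sub_nonneg.2 (hf hxy)) hv hvw) _

lemma deriv_eq_of_isLocalExtr_surplus (hf : DifferentiableAt ℝ f x) (hv : v ≠ 0)
    (hx : IsLocalExtr (surplus f v) x) : deriv f x = v :=
  ((div_eq_one_iff_eq hv).1 (sub_eq_zero.1 (hx.hasDerivAt_eq_zero (hasDerivAt_surplus hf v))).symm)

lemma continuous_surplus_deriv (hf : ContDiff ℝ 1 f) (hpos : ∀ x, 0 < deriv f x) :
    Continuous fun z : ℝ × ℝ => surplus f (deriv f z.1) z.2 :=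
  continuous_snd.sub ((hf.continuous.comp continuous_snd).div
    (hf.continuous_deriv_one.comp continuous_fst) fun z => (hpos z.1).ne')

lemma continuous_levelGain (hf : ContDiff ℝ 1 f) (hpos : ∀ x, 0 < deriv f x) (c : ℝ) :
    Continuous (levelGain f c) :=
  ((continuous_surplus_deriv hf hpos).comp (continuous_id.prodMk continuous_id)).sub
    ((continuous_surplus_deriv hf hpos).comp (continuous_id.prodMk continuous_const))

lemma strictMonoOn_levelGain {c : ℝ} (hf : Differentiable ℝ f) (hpos : ∀ x, 0 < deriv f x)
    (hs : s.OrdConnected) (hsc : s ⊆ Ici c) (hm : StrictMonoOn (deriv f) s) :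
    StrictMonoOn (levelGain f c) s := by
  intro x hx y hy hxy
  have hmono : Monotone f := (strictMono_of_deriv_pos hpos).monotone
  calc levelGain f c x
      ≤ surplus f (deriv f y) x - surplus f (deriv f y) c :=
        surplus_sub_surplus_le_of_le hmono (hpos x) (hm hx hy hxy).le (hsc hx)
    _ < levelGain f c y := sub_lt_sub_right
        (surplus_lt_surplus_of_strictMonoOn hf hs hm hy hx (hpos y) hxy.ne) _

lemma tendsto_levelGain_atTop {b : ℝ} (hf : Differentiable ℝ f)
    (hm : StrictMonoOn (deriv f) (Ici b)) (htop : Tendsto (deriv f) atTop atTop) (c : ℝ) :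
    Tendsto (levelGain f c) atTop atTop := by
  refine tendsto_atTop.2 fun K => ?_
  set M := max b (K + c + 1)
  filter_upwards [eventually_ge_atTop b, htop.eventually_gt_atTop 0,
    htop.eventually_ge_atTop (f M - f c)] with x hx hpos hge
  calc K ≤ M - c - 1 := by linarith [le_max_right b (K + c + 1)]
    _ ≤ M - c - (f M - f c) / deriv f x := sub_le_sub_left ((div_le_one hpos).2 hge) _
    _ = surplus f (deriv f x) M - surplus f (deriv f x) c := (surplus_sub_surplus _ _ _ _).symm
    _ ≤ levelGain f c x := sub_le_sub_right
        (surplus_le_surplus_of_strictMonoOn hf ordConnected_Ici hm hx (mem_Ici.2 (le_max_left _ _))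
          hpos) _

lemma surplus_sub_lt_of_strictMonoOn_Ici {c u : ℝ} (hf : Differentiable ℝ f)
    (hpos : ∀ x, 0 < deriv f x) (hm : StrictMonoOn (deriv f) (Ici c)) (hcu : c < u)
    (hcx : c ≤ x) (hxy : x ≤ y) (hne : (x, y) ≠ (c, u)) :
    surplus f (deriv f u) y - surplus f (deriv f u) x < levelGain f c u := by
  have hmax {z : ℝ} (hz : c ≤ z) (hzu : z ≠ u) :
      surplus f (deriv f u) z < surplus f (deriv f u) u :=
    surplus_lt_surplus_of_strictMonoOn hf ordConnected_Ici hm hcu.le hz (hpos u) hzu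
  have hgain : 0 < levelGain f c u := sub_pos.2 (hmax le_rfl hcu.ne)
  have hyu : surplus f (deriv f u) y ≤ surplus f (deriv f u) u :=
    surplus_le_surplus_of_strictMonoOn hf ordConnected_Ici hm hcu.le (hcx.trans hxy) (hpos u)
  rcases hcx.eq_or_lt with rfl | hcx
  · exact sub_lt_sub_right (hmax hxy fun h => hne (by rw [h])) _
  · rcases hxy.eq_or_lt with rfl | hxy
    · rwa [sub_self]
    rcases min_lt_iff.1 (min_surplus_lt_surplus hf (hpos u)
      (hm.mono Icc_subset_Ici_self) hcx hxy) with hlt | hlt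
    · exact (sub_lt_sub_left hlt _).trans_le (sub_le_sub_right hyu _)
    · linarith

end Surplus

section ThreePhase

/-- The properties of `g` that do not depend on the case: a `C¹` function whose derivative is
positive and tends to infinity. -/
structure IsSteep (f : ℝ → ℝ) : Prop where
  contDiff : ContDiff ℝ 1 f
  deriv_pos : ∀ x, 0 < deriv f x
  tendsto_deriv : Tendsto (deriv f) atTop atTop

/-- The shape of `g` in Case (ii), with `b = x₀`: the derivative increases on `[0, a]`, decreases on
`[a, b]` and increases again on `[b, ∞)`. -/
structure IsThreePhase (f : ℝ → ℝ) (a b : ℝ) : Prop extends IsSteep f where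
  pos_left : 0 < a
  left_lt_right : a < b
  mono_left : StrictMonoOn (deriv f) (Icc 0 a)
  anti_mid : StrictAntiOn (deriv f) (Icc a b)
  mono_right : StrictMonoOn (deriv f) (Ici b)

variable {f : ℝ → ℝ} {a b v x y : ℝ}

namespace IsSteep

lemma differentiable (h : IsSteep f) : Differentiable ℝ f := h.contDiff.differentiable_one

lemma continuous_deriv (h : IsSteep f) : Continuous (deriv f) := h.contDiff.continuous_deriv_one

lemma strictMono (h : IsSteep f) : StrictMono f := strictMono_of_deriv_pos h.deriv_pos

lemma deriv_right_eq (h : IsSteep f) (hv : 0 < v) (hxy : x < y)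
    (hmax : ∀ r, x ≤ r → surplus f v r ≤ surplus f v y) : deriv f y = v := by
  refine deriv_eq_of_isLocalExtr_surplus (h.differentiable y) hv.ne' (Or.inr ?_)
  filter_upwards [Ioi_mem_nhds hxy] with r hr using hmax r hr.le

lemma deriv_left_eq (h : IsSteep f) (hv : 0 < v) (hx : 0 < x) (hxy : x < y)
    (hmin : ∀ r, 0 ≤ r → r ≤ y → surplus f v x ≤ surplus f v r) : deriv f x = v := by
  refine deriv_eq_of_isLocalExtr_surplus (h.differentiable x) hv.ne' (Or.inl ?_)
  filter_upwards [Ioo_mem_nhds hx hxy] with r hr using hmin r hr.1.le hr.2.le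

lemma surplus_sub_lt_of_lt (h : IsSteep f) {β w : ℝ} (hβ : 0 < β) (hv : 0 < v) (hvw : v < w)
    (hxy : x ≤ y) (hle : surplus f w y - surplus f w x ≤ β) :
    surplus f v y - surplus f v x < β := by
  rcases hxy.eq_or_lt with rfl | hxy
  · rwa [sub_self]
  · exact (surplus_sub_surplus_lt_of_lt h.strictMono hv hvw hxy).trans_le hle

lemma bijOn_levelGain (h : IsSteep f) {c : ℝ} (hbc : c ≤ b)
    (hm : StrictMonoOn (deriv f) (Ici b)) :
    BijOn (levelGain f c) (Ici b) (Ici (levelGain f c b)) :=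
  bijOn_Ici_of_strictMonoOn (continuous_levelGain h.contDiff h.deriv_pos c).continuousOn
    (strictMonoOn_levelGain h.differentiable h.deriv_pos ordConnected_Ici
      (Ici_subset_Ici.2 hbc) hm)
    (tendsto_levelGain_atTop h.differentiable hm h.tendsto_deriv c)

lemma bijOn_deriv (h : IsSteep f) (hm : StrictMonoOn (deriv f) (Ici b)) :
    BijOn (deriv f) (Ici b) (Ici (deriv f b)) :=
  bijOn_Ici_of_strictMonoOn h.continuous_deriv.continuousOn hm h.tendsto_deriv

end IsSteep

/-- The intervals `[x, y]` among which the optimal ones are found in Case (ii). -/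
def IsCandidate (a b x y : ℝ) : Prop :=
  (x = 0 ∧ y ∈ Icc 0 a ∪ Ici b) ∨ (x ∈ Icc a b ∧ b ≤ y)

namespace IsThreePhase

lemma right_pos (h : IsThreePhase f a b) : 0 < b := h.pos_left.trans h.left_lt_right

lemma nonneg_of_isCandidate (h : IsThreePhase f a b) (hxy : IsCandidate a b x y) : 0 ≤ x :=
  hxy.elim (fun hxy => hxy.1.ge) fun hxy => h.pos_left.le.trans hxy.1.1

lemma le_of_isCandidate (h : IsThreePhase f a b) (hxy : IsCandidate a b x y) : x ≤ y := by
  rcases hxy with ⟨rfl, hy⟩ | ⟨hx, hy⟩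
  · exact hy.elim (fun hy => hy.1) h.right_pos.le.trans
  · exact hx.2.trans hy

lemma exists_left_endpoint (h : IsThreePhase f a b) (hv : 0 < v) (hx : 0 ≤ x) (hxy : x < y)
    (hS : surplus f v x < surplus f v y) :
    ∃ x', (x' = 0 ∨ x' ∈ Icc a b) ∧ x' ≤ y ∧ (x' = x ∨ surplus f v x' < surplus f v x) := by
  rcases hx.eq_or_lt with rfl | hx
  · exact ⟨0, Or.inl rfl, hxy.le, Or.inl rfl⟩
  rcases lt_or_ge x a with hxa | hax
  · have hmin := min_surplus_lt_surplus h.differentiable hv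
      (h.mono_left.mono (Icc_subset_Icc_right (min_le_right y a))) hx (lt_min hxy hxa)
    rcases min_lt_iff.1 hmin with hlt | hlt
    · exact ⟨0, Or.inl rfl, (hx.trans hxy).le, Or.inr hlt⟩
    · have hay : a ≤ y := le_of_not_ge fun hya => by
        rw [min_eq_left hya] at hlt
        exact hlt.not_gt hS
      rw [min_eq_right hay] at hlt
      exact ⟨a, Or.inr (left_mem_Icc.2 h.left_lt_right.le), hay, Or.inr hlt⟩
  rcases le_or_gt x b with hxb | hbx
  · exact ⟨x, Or.inr ⟨hax, hxb⟩, hxy.le, Or.inl rfl⟩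
  · have hmin := min_surplus_lt_surplus h.differentiable hv
      (h.mono_right.mono Icc_subset_Ici_self) hbx hxy
    exact ⟨b, Or.inr (right_mem_Icc.2 h.left_lt_right.le), (hbx.trans hxy).le,
      Or.inr ((min_lt_iff.1 hmin).resolve_right hS.not_gt)⟩

lemma exists_right_endpoint (h : IsThreePhase f a b) (hv : 0 < v) (hx : x = 0 ∨ x ∈ Icc a b)
    (hxy : x < y) (hS : surplus f v x < surplus f v y) :
    ∃ y' ∈ Icc 0 a ∪ Ici b, x ≤ y' ∧ (y' = y ∨ surplus f v y < surplus f v y') := by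
  have hx0 : 0 ≤ x := hx.elim (fun h0 => h0.ge) fun hx => h.pos_left.le.trans hx.1
  have hxb : x ≤ b := hx.elim (fun h0 => h0.trans_le h.right_pos.le) fun hx => hx.2
  rcases le_or_gt y a with hya | hay
  · exact ⟨y, Or.inl ⟨hx0.trans hxy.le, hya⟩, hxy.le, Or.inl rfl⟩
  rcases le_or_gt b y with hby | hyb
  · exact ⟨y, Or.inr hby, hxy.le, Or.inl rfl⟩
  have hmax := surplus_lt_max_surplus h.differentiable hv
    (h.anti_mid.mono (Icc_subset_Icc_left (le_max_right x a))) (max_lt hxy hay) hyb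
  rcases lt_max_iff.1 hmax with hlt | hlt
  · have hxa : x ≤ a := le_of_not_ge fun hax => by
      rw [max_eq_left hax] at hlt
      exact hlt.not_gt hS
    rw [max_eq_right hxa] at hlt
    exact ⟨a, Or.inl (right_mem_Icc.2 h.pos_left.le), hxa, Or.inr hlt⟩
  · exact ⟨b, Or.inr self_mem_Ici, hxb, Or.inr hlt⟩

lemma exists_isCandidate (h : IsThreePhase f a b) (hv : 0 < v) (hx : 0 ≤ x) (hxy : x ≤ y)
    (hS : surplus f v x < surplus f v y) :
    IsCandidate a b x y ∨ ∃ x' y', IsCandidate a b x' y' ∧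
      surplus f v y - surplus f v x < surplus f v y' - surplus f v x' := by
  have hlt : x < y := hxy.lt_of_ne fun h => hS.ne (by rw [h])
  obtain ⟨x', hx', hxy', hSx⟩ := h.exists_left_endpoint hv hx hlt hS
  have hSx' : surplus f v x' ≤ surplus f v x := hSx.elim (fun h => by rw [h]) le_of_lt
  have hlt' : x' < y := hxy'.lt_of_ne fun h => (hSx'.trans_lt hS).ne (by rw [h])
  obtain ⟨y', hy', hx'y', hSy⟩ := h.exists_right_endpoint hv hx' hlt' (hSx'.trans_lt hS)
  have hSy' : surplus f v y ≤ surplus f v y' := hSy.elim (fun h => by rw [h]) le_of_lt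
  have hlt'' : x' < y' := hx'y'.lt_of_ne fun h => (hSx'.trans_lt (hS.trans_le hSy')).ne (by rw [h])
  have hcand : IsCandidate a b x' y' := by
    rcases hx' with h0 | hx'
    · exact Or.inl ⟨h0, hy'⟩
    · exact Or.inr ⟨hx', hy'.resolve_left fun hy => (hx'.1.trans_lt hlt'').not_ge hy.2⟩
  rcases hSx with rfl | hSx
  · rcases hSy with rfl | hSy
    · exact Or.inl hcand
    · exact Or.inr ⟨x', y', hcand, sub_lt_sub_right hSy _⟩
  · exact Or.inr ⟨x', y', hcand, (sub_lt_sub_left hSx _).trans_le (sub_le_sub_right hSy' _)⟩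

variable {β : ℝ}

lemma surplus_sub_le (h : IsThreePhase f a b) (hv : 0 < v) (hβ : 0 ≤ β)
    (hcand : ∀ x y, IsCandidate a b x y → surplus f v y - surplus f v x ≤ β)
    (hx : 0 ≤ x) (hxy : x ≤ y) : surplus f v y - surplus f v x ≤ β := by
  rcases le_or_gt (surplus f v y) (surplus f v x) with hS | hS
  · exact (sub_nonpos.2 hS).trans hβ
  · rcases h.exists_isCandidate hv hx hxy hS with hxy | ⟨x', y', hxy', hlt⟩
    · exact hcand x y hxy
    · exact hlt.le.trans (hcand x' y' hxy')

lemma isCandidate_of_surplus_sub_eq (h : IsThreePhase f a b) (hv : 0 < v) (hβ : 0 < β)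
    (hcand : ∀ x y, IsCandidate a b x y → surplus f v y - surplus f v x ≤ β)
    (hx : 0 ≤ x) (hxy : x ≤ y) (heq : surplus f v y - surplus f v x = β) :
    IsCandidate a b x y := by
  rcases h.exists_isCandidate hv hx hxy (sub_pos.1 (hβ.trans_eq heq.symm)) with
    hxy | ⟨x', y', hxy', hlt⟩
  · exact hxy
  · exact absurd (hcand x' y' hxy') (heq ▸ hlt).not_ge

lemma lt_of_surplus_sub_eq (h : IsThreePhase f a b) (hβ : 0 < β) (hxy : IsCandidate a b x y)
    (heq : surplus f v y - surplus f v x = β) : x < y :=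
  (h.le_of_isCandidate hxy).lt_of_ne fun hne =>
    (sub_pos.1 (hβ.trans_eq heq.symm)).ne (congrArg (surplus f v) hne)

lemma deriv_right_eq_of_surplus_sub_eq (h : IsThreePhase f a b) (hv : 0 < v) (hβ : 0 < β)
    (hcand : ∀ x y, IsCandidate a b x y → surplus f v y - surplus f v x ≤ β)
    (hxy : IsCandidate a b x y) (heq : surplus f v y - surplus f v x = β) : deriv f y = v :=
  h.deriv_right_eq hv (h.lt_of_surplus_sub_eq hβ hxy heq) fun _ hr => sub_le_sub_iff_right _ |>.1
    ((h.surplus_sub_le hv hβ.le hcand (h.nonneg_of_isCandidate hxy) hr).trans_eq heq.symm)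

lemma deriv_left_eq_of_surplus_sub_eq (h : IsThreePhase f a b) (hv : 0 < v) (hβ : 0 < β)
    (hcand : ∀ x y, IsCandidate a b x y → surplus f v y - surplus f v x ≤ β)
    (hx : x ∈ Icc a b) (hy : b ≤ y) (heq : surplus f v y - surplus f v x = β) : deriv f x = v :=
  h.deriv_left_eq hv (h.pos_left.trans_le hx.1) (h.lt_of_surplus_sub_eq hβ (Or.inr ⟨hx, hy⟩) heq)
    fun _ h0 hr => sub_le_sub_iff_left _ |>.1
      ((h.surplus_sub_le hv hβ.le hcand h0 hr).trans_eq heq.symm)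

end IsThreePhase

end ThreePhase

namespace Params

variable {P : Params}

/-- The standing assumptions of the theorem: `a, q, σ₊, σ₋ > 0` and `μ₊ > 0 ≥ μ₋`. -/
structure Admissible (P : Params) : Prop where
  a_pos : 0 < P.a
  σp_pos : 0 < P.σp
  σm_pos : 0 < P.σm
  q_pos : 0 < P.q
  μp_pos : 0 < P.μp
  μm_nonpos : P.μm ≤ 0

/-- The coefficient of `e^{θ₂⁺(x-a)}` in `g` on `(a, ∞)`. -/
noncomputable def rightUp (P : Params) : ℝ := (1 - P.cp) * P.gm 0

/-- Minus the coefficient of `e^{-θ₁⁺(x-a)}` in `g` on `(a, ∞)`, as in `expPair`. -/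
noncomputable def rightDown (P : Params) : ℝ := P.gp 0 - P.cp * P.gm 0

/-- The coefficient of `e^{θ₂⁻(x-a)}` in `g` on `(-∞, a]`. -/
noncomputable def leftUp (P : Params) : ℝ := P.gm 0 - P.cm * P.gp 0

/-- Minus the coefficient of `e^{-θ₁⁻(x-a)}` in `g` on `(-∞, a]`, as in `expPair`. -/
noncomputable def leftDown (P : Params) : ℝ := (1 - P.cm) * P.gp 0

/-- The function equal to `g'` on `[a, ∞)`. -/
noncomputable def rightDeriv (P : Params) : ℝ → ℝ :=
  expPair (P.rightUp * P.θ2p) (-(P.rightDown * P.θ1p)) P.θ2p P.θ1p P.a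

/-- The function equal to `g'` on `(-∞, a]`. -/
noncomputable def leftDeriv (P : Params) : ℝ → ℝ :=
  expPair (P.leftUp * P.θ2m) (-(P.leftDown * P.θ1m)) P.θ2m P.θ1m P.a

lemma abs_lt_sqrt_sq_add {μ q σ : ℝ} (hq : 0 < q) (hσ : 0 < σ) :
    |μ| < √(μ ^ 2 + 2 * q * σ ^ 2) := by
  rw [← Real.sqrt_sq_eq_abs]
  exact Real.sqrt_lt_sqrt (sq_nonneg μ) (lt_add_of_pos_right _ (by positivity))

lemma g_eq_ite (x : ℝ) : P.g x =
    if P.a < x then expPair P.rightUp P.rightDown P.θ2p P.θ1p P.a x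
    else expPair P.leftUp P.leftDown P.θ2m P.θ1m P.a x := by
  simp only [g, gp, gm, expPair, rightUp, rightDown, leftUp, leftDown, neg_mul]
  split_ifs <;> ring

namespace Admissible

lemma θ1p_pos (h : P.Admissible) : 0 < P.θ1p :=
  div_pos (by linarith [neg_lt_of_abs_lt (abs_lt_sqrt_sq_add (μ := P.μp) h.q_pos h.σp_pos)])
    (pow_pos h.σp_pos 2)

lemma θ2p_pos (h : P.Admissible) : 0 < P.θ2p :=
  div_pos (sub_pos.2 (lt_of_abs_lt (abs_lt_sqrt_sq_add h.q_pos h.σp_pos))) (pow_pos h.σp_pos 2)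

lemma θ1m_pos (h : P.Admissible) : 0 < P.θ1m :=
  div_pos (by linarith [neg_lt_of_abs_lt (abs_lt_sqrt_sq_add (μ := P.μm) h.q_pos h.σm_pos)])
    (pow_pos h.σm_pos 2)

lemma θ2m_pos (h : P.Admissible) : 0 < P.θ2m :=
  div_pos (sub_pos.2 (lt_of_abs_lt (abs_lt_sqrt_sq_add h.q_pos h.σm_pos))) (pow_pos h.σm_pos 2)

lemma θ2p_lt_θ1p (h : P.Admissible) : P.θ2p < P.θ1p :=
  div_lt_div_of_pos_right (by linarith [h.μp_pos]) (pow_pos h.σp_pos 2)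

lemma θ1m_le_θ2m (h : P.Admissible) : P.θ1m ≤ P.θ2m :=
  div_le_div_of_nonneg_right (by linarith [h.μm_nonpos]) (pow_pos h.σm_pos 2).le

lemma θp_pos (h : P.Admissible) : 0 < P.θ2p + P.θ1p := add_pos h.θ2p_pos h.θ1p_pos

lemma θm_pos (h : P.Admissible) : 0 < P.θ2m + P.θ1m := add_pos h.θ2m_pos h.θ1m_pos

lemma cm_mul (h : P.Admissible) : P.cm * (P.θ2m + P.θ1m) = P.θ1m - P.θ1p :=
  div_mul_cancel₀ _ h.θm_pos.ne'

lemma cp_mul (h : P.Admissible) : P.cp * (P.θ2p + P.θ1p) = P.θ2p - P.θ2m :=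
  div_mul_cancel₀ _ h.θp_pos.ne'

lemma cm_lt_one (h : P.Admissible) : P.cm < 1 :=
  (div_lt_one h.θm_pos).2 (by linarith [h.θ2m_pos, h.θ1p_pos])

lemma cp_lt_one (h : P.Admissible) : P.cp < 1 :=
  (div_lt_one h.θp_pos).2 (by linarith [h.θ2m_pos, h.θ1p_pos])

lemma gp_zero (h : P.Admissible) : P.gp 0 = Real.exp (-(P.θ2m * P.a)) := by
  rw [gp, if_neg h.a_pos.not_gt]
  ring_nf

lemma gp_zero_pos (h : P.Admissible) : 0 < P.gp 0 := by
  rw [h.gp_zero]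
  exact Real.exp_pos _

lemma gm_zero (h : P.Admissible) :
    P.gm 0 = P.gp 0 * (P.cm + (1 - P.cm) * Real.exp ((P.θ1m + P.θ2m) * P.a)) := by
  have hexp : Real.exp (-P.θ1m * (0 - P.a)) =
      Real.exp (-(P.θ2m * P.a)) * Real.exp ((P.θ1m + P.θ2m) * P.a) := by
    rw [← Real.exp_add]
    ring_nf
  rw [gm, if_neg h.a_pos.not_gt, h.gp_zero, hexp, zero_sub, mul_neg]
  ring

lemma one_lt_gm_zero_div (h : P.Admissible) :
    1 < P.cm + (1 - P.cm) * Real.exp ((P.θ1m + P.θ2m) * P.a) := by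
  have hexp : 1 < Real.exp ((P.θ1m + P.θ2m) * P.a) :=
    Real.one_lt_exp_iff.2 (mul_pos (add_pos h.θ1m_pos h.θ2m_pos) h.a_pos)
  linarith [lt_mul_of_one_lt_right (sub_pos.2 h.cm_lt_one) hexp]

lemma gm_zero_pos (h : P.Admissible) : 0 < P.gm 0 := by
  rw [h.gm_zero]
  exact mul_pos h.gp_zero_pos (one_pos.trans h.one_lt_gm_zero_div)

lemma rightUp_pos (h : P.Admissible) : 0 < P.rightUp :=
  mul_pos (sub_pos.2 h.cp_lt_one) h.gm_zero_pos

lemma leftDown_pos (h : P.Admissible) : 0 < P.leftDown :=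
  mul_pos (sub_pos.2 h.cm_lt_one) h.gp_zero_pos

lemma leftUp_eq (h : P.Admissible) :
    P.leftUp = P.leftDown * Real.exp ((P.θ1m + P.θ2m) * P.a) := by
  rw [leftUp, leftDown, h.gm_zero]
  ring

lemma leftUp_pos (h : P.Admissible) : 0 < P.leftUp := by
  rw [h.leftUp_eq]
  exact mul_pos h.leftDown_pos (Real.exp_pos _)

lemma rightDeriv_a (h : P.Admissible) : P.rightDeriv P.a = P.leftDeriv P.a := by
  rw [rightDeriv, leftDeriv, expPair_self, expPair_self, rightUp, rightDown, leftUp, leftDown]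
  linear_combination (-P.gm 0) * h.cp_mul + P.gp 0 * h.cm_mul

lemma hasDerivAt_g (h : P.Admissible) (x : ℝ) :
    HasDerivAt P.g (if P.a < x then P.rightDeriv x else P.leftDeriv x) x := by
  rw [show P.g = _ from funext g_eq_ite]
  refine hasDerivAt_ite_lt (hasDerivAt_expPair _ _ _ _ _) (hasDerivAt_expPair _ _ _ _ _)
    ?_ h.rightDeriv_a x
  rw [expPair_self, expPair_self, rightUp, rightDown, leftUp, leftDown]
  ring

lemma g'_of_le (h : P.Admissible) {x : ℝ} (hx : x ≤ P.a) : P.g' x = P.leftDeriv x :=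
  (h.hasDerivAt_g x).deriv.trans (if_neg hx.not_gt)

lemma g'_of_ge (h : P.Admissible) {x : ℝ} (hx : P.a ≤ x) : P.g' x = P.rightDeriv x := by
  rcases hx.eq_or_lt with rfl | hx
  · rw [h.g'_of_le le_rfl, h.rightDeriv_a]
  · exact (h.hasDerivAt_g x).deriv.trans (if_pos hx)

lemma continuous_g' (h : P.Admissible) : Continuous P.g' := by
  have hg' : P.g' = fun x => if x ≤ P.a then P.leftDeriv x else P.rightDeriv x := by
    funext x
    split_ifs with hx
    · exact h.g'_of_le hx
    · exact h.g'_of_ge (not_le.1 hx).le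
  rw [hg']
  exact Continuous.if_le (continuous_expPair _ _ _ _ _) (continuous_expPair _ _ _ _ _)
    continuous_id continuous_const fun x hx => hx ▸ h.rightDeriv_a.symm

lemma leftDeriv_pos (h : P.Admissible) (x : ℝ) : 0 < P.leftDeriv x :=
  expPair_pos_iff.2 ((neg_neg_of_pos (mul_pos h.leftDown_pos h.θ1m_pos)).trans
    (mul_pos (mul_pos h.leftUp_pos h.θ2m_pos) (Real.exp_pos _)))

lemma rightDeriv_pos (h : P.Admissible) {x : ℝ} (hx : P.a ≤ x) : 0 < P.rightDeriv x := by
  refine expPair_pos_of_le (mul_pos h.rightUp_pos h.θ2p_pos).le h.θp_pos.le ?_ hx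
  have hpos : 0 < P.rightDeriv P.a := h.rightDeriv_a ▸ h.leftDeriv_pos P.a
  rwa [rightDeriv, expPair_self, sub_pos] at hpos

lemma g'_pos (h : P.Admissible) (x : ℝ) : 0 < P.g' x := by
  rcases le_total x P.a with hx | hx
  · exact h.g'_of_le hx ▸ h.leftDeriv_pos x
  · exact h.g'_of_ge hx ▸ h.rightDeriv_pos hx

lemma tendsto_g' (h : P.Admissible) : Tendsto P.g' atTop atTop := by
  have hright : Tendsto P.rightDeriv atTop atTop :=
    tendsto_expPair_atTop (mul_pos h.rightUp_pos h.θ2p_pos) h.θ2p_pos h.θ1p_pos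
  refine hright.congr' ?_
  filter_upwards [eventually_ge_atTop P.a] with x hx using (h.g'_of_ge hx).symm

lemma isSteep (h : P.Admissible) : IsSteep P.g where
  contDiff := contDiff_one_iff_deriv.2
    ⟨fun x => (h.hasDerivAt_g x).differentiableAt, h.continuous_g'⟩
  deriv_pos := h.g'_pos
  tendsto_deriv := h.tendsto_g'

lemma strictMonoOn_g'_left (h : P.Admissible) : StrictMonoOn P.g' (Icc 0 P.a) := by
  have hmono : StrictMonoOn P.leftDeriv (Ici 0) := by
    refine strictMonoOn_expPair (mul_pos (mul_pos h.leftUp_pos h.θ2m_pos) h.θ2m_pos) h.θm_pos ?_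
    have hexp : Real.exp ((P.θ1m + P.θ2m) * P.a) * Real.exp ((P.θ2m + P.θ1m) * (0 - P.a)) = 1 := by
      rw [← Real.exp_add, Real.exp_eq_one_iff]
      ring
    calc -(-(P.leftDown * P.θ1m) * P.θ1m)
        = P.leftDown * P.θ1m ^ 2 := by ring
      _ ≤ P.leftDown * P.θ2m ^ 2 := mul_le_mul_of_nonneg_left
          (pow_le_pow_left₀ h.θ1m_pos.le h.θ1m_le_θ2m 2) h.leftDown_pos.le
      _ = P.leftUp * P.θ2m * P.θ2m * Real.exp ((P.θ2m + P.θ1m) * (0 - P.a)) := by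
          rw [h.leftUp_eq]
          linear_combination (-(P.leftDown * P.θ2m ^ 2)) * hexp
  exact (hmono.mono Icc_subset_Ici_self).congr fun x hx => (h.g'_of_le hx.2).symm

lemma strictMonoOn_g'_right (h : P.Admissible) {b : ℝ} (hb : P.a ≤ b)
    (hle : P.rightDown * P.θ1p ^ 2 ≤
      P.rightUp * P.θ2p ^ 2 * Real.exp ((P.θ2p + P.θ1p) * (b - P.a))) :
    StrictMonoOn P.g' (Ici b) := by
  refine StrictMonoOn.congr (f₁ := P.rightDeriv) (strictMonoOn_expPair
    (mul_pos (mul_pos h.rightUp_pos h.θ2p_pos) h.θ2p_pos) h.θp_pos ?_)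
    fun x hx => (h.g'_of_ge (hb.trans hx)).symm
  linarith

lemma strictAntiOn_g'_mid (h : P.Admissible) {b : ℝ}
    (hle : P.rightUp * P.θ2p ^ 2 * Real.exp ((P.θ2p + P.θ1p) * (b - P.a)) ≤
      P.rightDown * P.θ1p ^ 2) :
    StrictAntiOn P.g' (Icc P.a b) := by
  refine StrictAntiOn.congr (f₁ := P.rightDeriv) ((strictAntiOn_expPair
    (mul_pos (mul_pos h.rightUp_pos h.θ2p_pos) h.θ2p_pos) h.θp_pos ?_).mono Icc_subset_Iic_self)
    fun x hx => (h.g'_of_ge hx.1).symm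
  linarith

-- The second derivative of `g` at `a+` is `rightUp * θ2p ^ 2 - rightDown * θ1p ^ 2`.
lemma rightDown_mul_le_iff (h : P.Admissible) :
    P.rightDown * P.θ1p ^ 2 ≤ P.rightUp * P.θ2p ^ 2 ↔
      P.θ1p ^ 2 ≤ (P.cm + (1 - P.cm) * Real.exp ((P.θ1m + P.θ2m) * P.a)) * P.Θ := by
  have hdiff : P.rightUp * P.θ2p ^ 2 - P.rightDown * P.θ1p ^ 2 = P.gp 0 *
      ((P.cm + (1 - P.cm) * Real.exp ((P.θ1m + P.θ2m) * P.a)) * P.Θ - P.θ1p ^ 2) := by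
    rw [rightDown, rightUp, Θ, h.gm_zero]
    ring
  rw [← sub_nonneg, hdiff, mul_nonneg_iff_of_pos_left h.gp_zero_pos, sub_nonneg]

lemma Θ_lt_sq (h : P.Admissible) : P.Θ < P.θ1p ^ 2 := by
  have hsq : P.θ2p ^ 2 < P.θ1p ^ 2 := pow_lt_pow_left₀ h.θ2p_lt_θ1p h.θ2p_pos.le two_ne_zero
  rw [Θ]
  linarith [mul_lt_mul_of_pos_left hsq (sub_pos.2 h.cp_lt_one)]

lemma Θ_pos (h : P.Admissible) (hcp : 0 < P.cp) : 0 < P.Θ :=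
  add_pos (mul_pos hcp (pow_pos h.θ1p_pos 2))
    (mul_pos (sub_pos.2 h.cp_lt_one) (pow_pos h.θ2p_pos 2))

lemma a3_le_iff (h : P.Admissible) (hΘ : 0 < P.Θ) :
    P.a3 ≤ P.a ↔ P.rightDown * P.θ1p ^ 2 ≤ P.rightUp * P.θ2p ^ 2 := by
  have hnum : (1 - P.cm * P.cp) * P.θ1p ^ 2 - (1 - P.cp) * P.cm * P.θ2p ^ 2 =
      P.θ1p ^ 2 - P.cm * P.Θ := by
    rw [Θ]
    ring
  have hlt : P.cm * P.Θ < P.θ1p ^ 2 := (mul_lt_of_lt_one_left hΘ h.cm_lt_one).trans h.Θ_lt_sq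
  rw [h.rightDown_mul_le_iff, a3, hnum,
    log_div_div_le_iff (add_pos h.θ1m_pos h.θ2m_pos) h.cm_lt_one hΘ hlt]

lemma a2_le_iff (h : P.Admissible) (hcp : 0 < P.cp) : P.a2 ≤ P.a ↔ P.rightDown ≤ 0 := by
  have hdiff : 0 < P.θ2p - P.θ2m := h.cp_mul ▸ mul_pos hcp h.θp_pos
  have harg : (P.θ2p + P.θ1m) / (P.θ2p - P.θ2m) =
      (1 - P.cm * P.cp) / ((1 - P.cm) * P.cp) := by
    rw [div_eq_div_iff hdiff.ne' (mul_pos (sub_pos.2 h.cm_lt_one) hcp).ne']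
    linear_combination h.cp_mul - P.cp * h.cm_mul
  have hlt : P.cm * P.cp < 1 := (mul_lt_of_lt_one_left hcp h.cm_lt_one).trans h.cp_lt_one
  have hdown : -P.rightDown = P.gp 0 *
      ((P.cm + (1 - P.cm) * Real.exp ((P.θ1m + P.θ2m) * P.a)) * P.cp - 1) := by
    rw [rightDown, h.gm_zero]
    ring
  rw [a2, harg, log_div_div_le_iff (add_pos h.θ1m_pos h.θ2m_pos) h.cm_lt_one hcp hlt,
    ← neg_nonneg (a := P.rightDown), hdown, mul_nonneg_iff_of_pos_left h.gp_zero_pos, sub_nonneg]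

lemma rightDown_mul_le_of_caseI (h : P.Admissible) (hc : P.CaseI) :
    P.rightDown * P.θ1p ^ 2 ≤ P.rightUp * P.θ2p ^ 2 := by
  rcases hc with ⟨hcp, ha⟩ | ⟨hcp, -, ha, -⟩ | ⟨-, ha, hΘ⟩
  · calc P.rightDown * P.θ1p ^ 2
        ≤ 0 := mul_nonpos_of_nonpos_of_nonneg ((h.a2_le_iff hcp).1 ha) (sq_nonneg _)
      _ ≤ P.rightUp * P.θ2p ^ 2 := mul_nonneg h.rightUp_pos.le (sq_nonneg _)
  · exact (h.a3_le_iff (h.Θ_pos hcp)).1 ha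
  · exact (h.a3_le_iff hΘ).1 ha

lemma lt_rightDown_mul_of_caseII (h : P.Admissible) (hc : P.CaseII) :
    P.rightUp * P.θ2p ^ 2 < P.rightDown * P.θ1p ^ 2 := by
  rcases hc with ⟨hcp, -, ha⟩ | ⟨-, hΘ⟩ | ⟨-, -, ha, hΘ⟩
  · exact not_le.1 fun hle =>
      (ha.trans_le (min_le_right _ _)).not_ge ((h.a3_le_iff (h.Θ_pos hcp)).2 hle)
  · refine not_le.1 fun hle => (pow_pos h.θ1p_pos 2).not_ge ?_
    exact (h.rightDown_mul_le_iff.1 hle).trans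
      (mul_nonpos_of_nonneg_of_nonpos (one_pos.trans h.one_lt_gm_zero_div).le hΘ)
  · exact not_le.1 fun hle => ha.not_ge ((h.a3_le_iff hΘ).2 hle)

lemma exp_x0 (h : P.Admissible) (hlt : P.rightUp * P.θ2p ^ 2 < P.rightDown * P.θ1p ^ 2) :
    P.rightUp * P.θ2p ^ 2 * Real.exp ((P.θ2p + P.θ1p) * (P.x0 - P.a)) =
      P.rightDown * P.θ1p ^ 2 := by
  have hup : 0 < P.rightUp * P.θ2p ^ 2 := mul_pos h.rightUp_pos (pow_pos h.θ2p_pos 2)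
  have hlog : (P.θ2p + P.θ1p) * (P.x0 - P.a) =
      Real.log ((P.rightDown * P.θ1p ^ 2) / (P.rightUp * P.θ2p ^ 2)) := by
    rw [x0, add_sub_cancel_right, mul_div_cancel₀ _ h.θp_pos.ne', rightDown, rightUp]
  rw [hlog, Real.exp_log (div_pos (hup.trans hlt) hup), mul_div_cancel₀ _ hup.ne']

lemma a_lt_x0 (h : P.Admissible) (hlt : P.rightUp * P.θ2p ^ 2 < P.rightDown * P.θ1p ^ 2) :
    P.a < P.x0 := by
  have hup : 0 < P.rightUp * P.θ2p ^ 2 := mul_pos h.rightUp_pos (pow_pos h.θ2p_pos 2)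
  have hexp : 1 < Real.exp ((P.θ2p + P.θ1p) * (P.x0 - P.a)) :=
    (lt_mul_iff_one_lt_right hup).1 (hlt.trans_eq (h.exp_x0 hlt).symm)
  exact sub_pos.1 ((mul_pos_iff_of_pos_left h.θp_pos).1 (Real.one_lt_exp_iff.1 hexp))

lemma strictMonoOn_g'_of_caseI (h : P.Admissible) (hc : P.CaseI) :
    StrictMonoOn P.g' (Ici 0) := by
  have hright : StrictMonoOn P.g' (Ici P.a) := by
    refine h.strictMonoOn_g'_right le_rfl ?_
    rw [sub_self, mul_zero, Real.exp_zero, mul_one]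
    exact h.rightDown_mul_le_of_caseI hc
  rw [← Icc_union_Ici_eq_Ici h.a_pos.le]
  exact h.strictMonoOn_g'_left.union hright (isGreatest_Icc h.a_pos.le) isLeast_Ici

lemma isThreePhase_of_caseII (h : P.Admissible) (hc : P.CaseII) :
    IsThreePhase P.g P.a P.x0 where
  toIsSteep := h.isSteep
  pos_left := h.a_pos
  left_lt_right := h.a_lt_x0 (h.lt_rightDown_mul_of_caseII hc)
  mono_left := h.strictMonoOn_g'_left
  anti_mid := h.strictAntiOn_g'_mid (h.exp_x0 (h.lt_rightDown_mul_of_caseII hc)).le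
  mono_right := h.strictMonoOn_g'_right (h.a_lt_x0 (h.lt_rightDown_mul_of_caseII hc)).le
    (h.exp_x0 (h.lt_rightDown_mul_of_caseII hc)).ge

end Admissible

variable {β v x y : ℝ}

section Dinkelbach

lemma φ0_eq_levelGain (h : IsSteep P.g) : P.φ0 = levelGain P.g 0 :=
  funext fun x => integral_one_sub_deriv_div h.contDiff (P.g' x) 0 x

-- Dinkelbach's principle: `(x, y)` maximizes the ratio `N / D` with value `1 / v` exactly if it
-- maximizes `v * N - D` with value `0`.
lemma mem_Mζ_iff (h : IsSteep P.g) (hβ : 0 < β) (hv : 0 < v)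
    (hle : ∀ x y, 0 ≤ x → x ≤ y → surplus P.g v y - surplus P.g v x ≤ β)
    (hex : ∃ x y, 0 ≤ x ∧ x ≤ y ∧ surplus P.g v y - surplus P.g v x = β) :
    (x, y) ∈ P.Mζ β ↔ 0 ≤ x ∧ x ≤ y ∧ surplus P.g v y - surplus P.g v x = β := by
  have hlt_of_mem : ∀ z ∈ Dζ β, z.1 < z.2 := fun z hz => (lt_add_of_pos_right _ hβ).trans_le hz.2.2
  have hmem_of_eq {x y : ℝ} (hx : 0 ≤ x) (hxy : x ≤ y)
      (heq : surplus P.g v y - surplus P.g v x = β) : (x, y) ∈ Dζ β := by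
    have hnonneg : 0 ≤ (P.g y - P.g x) / v :=
      div_nonneg (sub_nonneg.2 (h.strictMono.monotone hxy)) hv.le
    rw [surplus_sub_surplus] at heq
    exact ⟨hx, hx.trans hxy, by dsimp only; linarith⟩
  have hratio {z : ℝ × ℝ} : surplus P.g v z.2 - surplus P.g v z.1 = β ↔
      z.2 - z.1 - β = v⁻¹ * (P.g z.2 - P.g z.1) := by
    rw [surplus_sub_surplus, div_eq_inv_mul]
    constructor <;> intro heq <;> linarith
  obtain ⟨x₀, y₀, hx₀, hxy₀, heq₀⟩ := hex
  have hmax {z : ℝ × ℝ} (hz : z ∈ Dζ β) :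
      IsMaxOn (fun z => (z.2 - z.1 - β) / (P.g z.2 - P.g z.1)) (Dζ β) z ↔
        z.2 - z.1 - β = v⁻¹ * (P.g z.2 - P.g z.1) := by
    refine isMaxOn_div_iff (fun z hz => sub_pos.2 (h.strictMono (hlt_of_mem z hz)))
      (fun z hz => ?_) ⟨(x₀, y₀), hmem_of_eq hx₀ hxy₀ heq₀, hratio.1 heq₀⟩ hz
    have hz' := hle z.1 z.2 hz.1 (hlt_of_mem z hz).le
    rw [surplus_sub_surplus, div_eq_inv_mul] at hz'
    linarith
  constructor
  · exact fun hz => ⟨hz.1.1, (hlt_of_mem _ hz.1).le, hratio.2 ((hmax hz.1).1 hz.2)⟩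
  · rintro ⟨hx, hxy, heq⟩
    exact ⟨hmem_of_eq hx hxy heq, (hmax (hmem_of_eq hx hxy heq)).2 (hratio.1 heq)⟩

end Dinkelbach

section CaseI

lemma bijOn_φ0 (h : IsSteep P.g) (hm : StrictMonoOn P.g' (Ici 0)) :
    BijOn P.φ0 (Ici 0) (Ici 0) := by
  have hbij := h.bijOn_levelGain le_rfl hm
  rwa [levelGain_self, ← φ0_eq_levelGain h] at hbij

lemma Mζ_eq_of_strictMonoOn (h : IsSteep P.g) (hm : StrictMonoOn P.g' (Ici 0)) (hβ : 0 < β) :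
    P.Mζ β = {(0, P.φ0Inv β)} := by
  have hmem : ∃ x ∈ Ici (0 : ℝ), P.φ0 x = β := (bijOn_φ0 h hm).surjOn hβ.le
  have hgain : levelGain P.g 0 (P.φ0Inv β) = β := by
    rw [← φ0_eq_levelGain h]
    exact Function.invFunOn_eq hmem
  have hpos : 0 < P.φ0Inv β := by
    refine lt_of_le_of_ne (Function.invFunOn_mem hmem) fun h0 => hβ.ne ?_
    rw [← hgain, ← h0, levelGain_self]
  have hlt {x y : ℝ} (hx : 0 ≤ x) (hxy : x ≤ y) (hne : (x, y) ≠ (0, P.φ0Inv β)) :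
      surplus P.g (P.g' (P.φ0Inv β)) y - surplus P.g (P.g' (P.φ0Inv β)) x < β :=
    (surplus_sub_lt_of_strictMonoOn_Ici h.differentiable h.deriv_pos hm hpos hx hxy hne).trans_eq
      hgain
  ext ⟨x, y⟩
  rw [mem_Mζ_iff h hβ (h.deriv_pos _) (fun x y hx hxy => ?_) ⟨0, _, le_rfl, hpos.le, hgain⟩,
    mem_singleton_iff]
  · refine ⟨fun hz => of_not_not fun hne => (hlt hz.1 hz.2.1 hne).ne hz.2.2, ?_⟩
    rintro ⟨⟩
    exact ⟨le_rfl, hpos.le, hgain⟩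
  · rcases eq_or_ne (x, y) (0, P.φ0Inv β) with heq | hne
    · obtain ⟨rfl, rfl⟩ := Prod.ext_iff.1 heq
      exact hgain.le
    · exact (hlt hx hxy hne).le

end CaseI

end Params

section Envelope

variable {f m : ℝ → ℝ} {s K : Set ℝ}

lemma continuousOn_surplus_of_isMin (hf : ContDiff ℝ 1 f) (hpos : ∀ x, 0 < deriv f x)
    (hK : IsCompact K) (hm : ∀ x ∈ s, m x ∈ K)
    (hmin : ∀ x ∈ s, ∀ p ∈ K, surplus f (deriv f x) (m x) ≤ surplus f (deriv f x) p) :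
    ContinuousOn (fun x => surplus f (deriv f x) (m x)) s := by
  have hcont : Continuous fun x => sInf (surplus f (deriv f x) '' K) :=
    hK.continuous_sInf (f := fun x => surplus f (deriv f x)) (continuous_surplus_deriv hf hpos)
  exact hcont.continuousOn.congr fun x hx =>
    (IsLeast.csInf_eq ⟨mem_image_of_mem _ (hm x hx), forall_mem_image.2 (hmin x hx)⟩).symm

lemma continuousOn_surplus_of_isMax (hf : ContDiff ℝ 1 f) (hpos : ∀ x, 0 < deriv f x)
    (hK : IsCompact K) (hm : ∀ x ∈ s, m x ∈ K)
    (hmax : ∀ x ∈ s, ∀ p ∈ K, surplus f (deriv f x) p ≤ surplus f (deriv f x) (m x)) :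
    ContinuousOn (fun x => surplus f (deriv f x) (m x)) s := by
  have hcont : Continuous fun x => sSup (surplus f (deriv f x) '' K) :=
    hK.continuous_sSup (f := fun x => surplus f (deriv f x)) (continuous_surplus_deriv hf hpos)
  exact hcont.continuousOn.congr fun x hx =>
    (IsGreatest.csSup_eq ⟨mem_image_of_mem _ (hm x hx), forall_mem_image.2 (hmax x hx)⟩).symm

end Envelope

namespace Params

/-- The function whose first zero on `[x₀, a₇]` is `x₃`: how much better it is, at the level
`g'(x)`, to start at `0` than at the best point of `[a, x₀]`. -/
noncomputable def startGap (P : Params) (x : ℝ) : ℝ :=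
  ∫ s in (0 : ℝ)..P.gInvPlus (P.g' x), (1 - P.g' s / P.g' x)

/-- The function whose first zero on `[x₀, a₇]` is `x₄`: how much better it is, at the level
`g'(x)`, to stop at `x` than at the best point of `[0, a]`. -/
noncomputable def stopGap (P : Params) (x : ℝ) : ℝ :=
  ∫ s in P.gInvMinus (P.g' x)..x, (1 - P.g' s / P.g' x)

end Params

namespace IsThreePhase

variable {P : Params} {p v x y : ℝ}

section Inverses

lemma g'_x0_lt_g'_a (h : IsThreePhase P.g P.a P.x0) : P.g' P.x0 < P.g' P.a :=
  h.anti_mid (left_mem_Icc.2 h.left_lt_right.le) (right_mem_Icc.2 h.left_lt_right.le)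
    h.left_lt_right

lemma a7_spec (h : IsThreePhase P.g P.a P.x0) : P.x0 < P.a7 ∧ P.g' P.a7 = P.g' P.a := by
  obtain ⟨x, hx, hxa⟩ := (h.bijOn_deriv h.mono_right).surjOn h.g'_x0_lt_g'_a.le
  have hlt : P.x0 < x := lt_of_le_of_ne hx fun h0 => h.g'_x0_lt_g'_a.ne (h0 ▸ hxa)
  have ha7 : P.a7 = x := IsGreatest.csSup_eq ⟨⟨hlt, hxa.le⟩, fun y hy =>
    (h.mono_right.le_iff_le hy.1.le hx).1 (hy.2.trans_eq hxa.symm)⟩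
  exact ha7 ▸ ⟨hlt, hxa⟩

lemma x0_lt_a7 (h : IsThreePhase P.g P.a P.x0) : P.x0 < P.a7 := h.a7_spec.1

lemma g'_a7 (h : IsThreePhase P.g P.a P.x0) : P.g' P.a7 = P.g' P.a := h.a7_spec.2

lemma g'_le_g'_iff (h : IsThreePhase P.g P.a P.x0) (hx : P.x0 ≤ x) (hy : P.x0 ≤ y) :
    P.g' x ≤ P.g' y ↔ x ≤ y :=
  h.mono_right.le_iff_le hx hy

lemma g'_le_g'_a (h : IsThreePhase P.g P.a P.x0) (hx : x ∈ Icc P.x0 P.a7) : P.g' x ≤ P.g' P.a :=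
  h.g'_a7 ▸ (h.g'_le_g'_iff hx.1 h.x0_lt_a7.le).2 hx.2

lemma g'_mem_of_mem (h : IsThreePhase P.g P.a P.x0) (hx : x ∈ Icc P.x0 P.a7) :
    P.g' x ∈ Icc (P.g' P.x0) (P.g' P.a7) :=
  ⟨(h.g'_le_g'_iff le_rfl hx.1).2 hx.1, (h.g'_le_g'_iff hx.1 h.x0_lt_a7.le).2 hx.2⟩

lemma bijOn_g'_mid (h : IsThreePhase P.g P.a P.x0) :
    BijOn P.g' (Icc P.a P.x0) (Icc (P.g' P.x0) (P.g' P.a7)) := by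
  rw [h.g'_a7]
  refine ⟨fun x hx => ⟨?_, ?_⟩, h.anti_mid.injOn, ?_⟩
  · exact h.anti_mid.antitoneOn hx (right_mem_Icc.2 h.left_lt_right.le) hx.2
  · exact h.anti_mid.antitoneOn (left_mem_Icc.2 h.left_lt_right.le) hx hx.1
  · exact intermediate_value_Icc' h.left_lt_right.le h.continuous_deriv.continuousOn

lemma gInvPlus_mem (h : IsThreePhase P.g P.a P.x0) (hv : v ∈ Icc (P.g' P.x0) (P.g' P.a7)) :
    P.gInvPlus v ∈ Icc P.a P.x0 :=
  Function.invFunOn_mem (h.bijOn_g'_mid.surjOn hv)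

lemma g'_gInvPlus (h : IsThreePhase P.g P.a P.x0) (hv : v ∈ Icc (P.g' P.x0) (P.g' P.a7)) :
    P.g' (P.gInvPlus v) = v :=
  Function.invFunOn_eq (h.bijOn_g'_mid.surjOn hv)

lemma surplus_gInvPlus_le (h : IsThreePhase P.g P.a P.x0)
    (hv : v ∈ Icc (P.g' P.x0) (P.g' P.a7)) (hp : p ∈ Icc P.a P.x0) :
    surplus P.g v (P.gInvPlus v) ≤ surplus P.g v p := by
  have hle := surplus_le_surplus_of_strictAntiOn h.differentiable ordConnected_Icc h.anti_mid
    (h.gInvPlus_mem hv) hp (h.deriv_pos _)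
  rwa [← Params.g', h.g'_gInvPlus hv] at hle

lemma gInvMinus_spec (h : IsThreePhase P.g P.a P.x0) (hv : v ≤ P.g' P.a) :
    P.gInvMinus v ∈ Icc 0 P.a ∧ v ≤ P.g' (P.gInvMinus v) :=
  sInf_le_apply_mem h.pos_left.le h.continuous_deriv.continuousOn hv

lemma g'_gInvMinus (h : IsThreePhase P.g P.a P.x0) (hv : v ≤ P.g' P.a)
    (hpos : 0 < P.gInvMinus v) : P.g' (P.gInvMinus v) = v :=
  apply_sInf_le_apply_eq h.pos_left.le h.continuous_deriv.continuousOn hv hpos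

lemma surplus_le_gInvMinus (h : IsThreePhase P.g P.a P.x0) (hv0 : 0 < v) (hv : v ≤ P.g' P.a)
    (hy : y ∈ Icc 0 P.a) : surplus P.g v y ≤ surplus P.g v (P.gInvMinus v) := by
  obtain ⟨hm, hge⟩ := h.gInvMinus_spec hv
  rcases lt_trichotomy y (P.gInvMinus v) with hlt | rfl | hlt
  · exact (surplus_lt_of_deriv_lt h.differentiable hv0 hlt fun s hs =>
      apply_lt_of_lt_sInf_le_apply (hy.1.trans hs.1.le) (hs.2.le.trans hm.2) hs.2).le
  · exact le_rfl
  · exact (surplus_lt_of_lt_deriv h.differentiable hv0 hlt fun s hs => hge.trans_lt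
      (h.mono_left hm ⟨hm.1.trans hs.1.le, hs.2.le.trans hy.2⟩ hs.1)).le

end Inverses

section Thresholds

lemma surplus_le_left (h : IsThreePhase P.g P.a P.x0) (hx : x ∈ Icc 0 P.a) (hy : y ∈ Icc 0 P.a) :
    surplus P.g (P.g' x) y ≤ surplus P.g (P.g' x) x :=
  surplus_le_surplus_of_strictMonoOn h.differentiable ordConnected_Icc h.mono_left hx hy
    (h.deriv_pos x)

lemma surplus_lt_right (h : IsThreePhase P.g P.a P.x0) (hx : P.x0 ≤ x) (hy : P.x0 ≤ y)
    (hne : y ≠ x) : surplus P.g (P.g' x) y < surplus P.g (P.g' x) x :=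
  surplus_lt_surplus_of_strictMonoOn h.differentiable ordConnected_Ici h.mono_right hx hy
    (h.deriv_pos x) hne

lemma surplus_le_right (h : IsThreePhase P.g P.a P.x0) (hx : P.x0 ≤ x) (hy : P.x0 ≤ y) :
    surplus P.g (P.g' x) y ≤ surplus P.g (P.g' x) x :=
  surplus_le_surplus_of_strictMonoOn h.differentiable ordConnected_Ici h.mono_right hx hy
    (h.deriv_pos x)

lemma startGap_eq (h : IsThreePhase P.g P.a P.x0) : P.startGap = fun x =>
    surplus P.g (P.g' x) (P.gInvPlus (P.g' x)) - surplus P.g (P.g' x) 0 :=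
  funext fun x => integral_one_sub_deriv_div h.contDiff (P.g' x) 0 _

lemma stopGap_eq (h : IsThreePhase P.g P.a P.x0) : P.stopGap = fun x =>
    surplus P.g (P.g' x) x - surplus P.g (P.g' x) (P.gInvMinus (P.g' x)) :=
  funext fun x => integral_one_sub_deriv_div h.contDiff (P.g' x) _ x

lemma continuousOn_startGap (h : IsThreePhase P.g P.a P.x0) :
    ContinuousOn P.startGap (Icc P.x0 P.a7) := by
  rw [h.startGap_eq]
  exact (continuousOn_surplus_of_isMin h.contDiff h.deriv_pos isCompact_Icc
      (fun x hx => h.gInvPlus_mem (h.g'_mem_of_mem hx))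
      fun x hx p hp => h.surplus_gInvPlus_le (h.g'_mem_of_mem hx) hp).sub
    ((continuous_surplus_deriv h.contDiff h.deriv_pos).comp
      (continuous_id.prodMk continuous_const)).continuousOn

lemma continuousOn_stopGap (h : IsThreePhase P.g P.a P.x0) :
    ContinuousOn P.stopGap (Icc P.x0 P.a7) := by
  rw [h.stopGap_eq]
  exact ((continuous_surplus_deriv h.contDiff h.deriv_pos).comp
      (continuous_id.prodMk continuous_id)).continuousOn.sub
    (continuousOn_surplus_of_isMax h.contDiff h.deriv_pos isCompact_Icc
      (fun x hx => (h.gInvMinus_spec (h.g'_le_g'_a hx)).1)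
      fun x hx y hy => h.surplus_le_gInvMinus (h.deriv_pos x) (h.g'_le_g'_a hx) hy)

lemma startGap_a7_nonneg (h : IsThreePhase P.g P.a P.x0) : 0 ≤ P.startGap P.a7 := by
  have hp := h.gInvPlus_mem (right_mem_Icc.2 (h.g'_a7 ▸ h.g'_x0_lt_g'_a.le))
  rw [h.startGap_eq, sub_nonneg]
  rw [h.g'_a7] at hp ⊢
  have hmid : surplus P.g (P.g' P.a) P.a ≤ surplus P.g (P.g' P.a) (P.gInvPlus (P.g' P.a)) :=
    surplus_le_surplus_of_strictAntiOn h.differentiable ordConnected_Icc h.anti_mid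
      (left_mem_Icc.2 h.left_lt_right.le) hp (h.deriv_pos _)
  exact (h.surplus_le_left (right_mem_Icc.2 h.pos_left.le) (left_mem_Icc.2 h.pos_left.le)).trans
    hmid

lemma stopGap_a7_nonneg (h : IsThreePhase P.g P.a P.x0) : 0 ≤ P.stopGap P.a7 := by
  have ha : P.a ∈ Icc 0 P.a := right_mem_Icc.2 h.pos_left.le
  have hmid : surplus P.g (P.g' P.a) P.a < surplus P.g (P.g' P.a) P.x0 :=
    surplus_lt_surplus_of_strictAntiOn h.differentiable ordConnected_Icc h.anti_mid
      (left_mem_Icc.2 h.left_lt_right.le) (right_mem_Icc.2 h.left_lt_right.le) (h.deriv_pos _)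
      h.left_lt_right.ne'
  have hright := h.surplus_le_right h.x0_lt_a7.le le_rfl
  rw [h.stopGap_eq, sub_nonneg]
  rw [h.g'_a7] at hright ⊢
  exact (h.surplus_le_left ha (h.gInvMinus_spec le_rfl).1).trans (hmid.le.trans hright)

lemma x3_spec (h : IsThreePhase P.g P.a P.x0) : P.x3 ∈ Icc P.x0 P.a7 ∧ 0 ≤ P.startGap P.x3 :=
  sInf_le_apply_mem h.x0_lt_a7.le h.continuousOn_startGap h.startGap_a7_nonneg

lemma x4_spec (h : IsThreePhase P.g P.a P.x0) : P.x4 ∈ Icc P.x0 P.a7 ∧ 0 ≤ P.stopGap P.x4 :=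
  sInf_le_apply_mem h.x0_lt_a7.le h.continuousOn_stopGap h.stopGap_a7_nonneg

lemma startGap_neg_of_lt_x3 (h : IsThreePhase P.g P.a P.x0) (hx : P.x0 ≤ x) (hlt : x < P.x3) :
    P.startGap x < 0 :=
  apply_lt_of_lt_sInf_le_apply hx (hlt.le.trans h.x3_spec.1.2) hlt

lemma stopGap_neg_of_lt_x4 (h : IsThreePhase P.g P.a P.x0) (hx : P.x0 ≤ x) (hlt : x < P.x4) :
    P.stopGap x < 0 :=
  apply_lt_of_lt_sInf_le_apply hx (hlt.le.trans h.x4_spec.1.2) hlt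

end Thresholds

end IsThreePhase

namespace Params

/-- The point at which `ω₄` starts its integral up to `x`. -/
noncomputable def ω4Start (P : Params) (x : ℝ) : ℝ := if x < P.x3 then P.gInvPlus (P.g' x) else 0

end Params

namespace IsThreePhase

variable {P : Params} {β p r u v x y : ℝ}

section OmegaFour

lemma x0_le_x3 (h : IsThreePhase P.g P.a P.x0) : P.x0 ≤ P.x3 := h.x3_spec.1.1

lemma g'_mem_of_le_x3 (h : IsThreePhase P.g P.a P.x0) (hx : P.x0 ≤ x) (hx3 : x ≤ P.x3) :
    P.g' x ∈ Icc (P.g' P.x0) (P.g' P.a7) :=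
  h.g'_mem_of_mem ⟨hx, hx3.trans h.x3_spec.1.2⟩

lemma surplus_zero_le_of_x3_le (h : IsThreePhase P.g P.a P.x0) (hx : P.x3 ≤ x)
    (hp : p ∈ Icc P.a P.x0) : surplus P.g (P.g' x) 0 ≤ surplus P.g (P.g' x) p := by
  have hgap := h.x3_spec.2
  rw [h.startGap_eq, sub_nonneg] at hgap
  have hx3 := hgap.trans (h.surplus_gInvPlus_le (h.g'_mem_of_le_x3 h.x0_le_x3 le_rfl) hp)
  have hinc := surplus_sub_surplus_le_of_le h.strictMono.monotone (h.deriv_pos P.x3)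
    ((h.g'_le_g'_iff h.x0_le_x3 (h.x0_le_x3.trans hx)).2 hx) (h.pos_left.le.trans hp.1)
  exact sub_nonneg.1 ((sub_nonneg.2 hx3).trans hinc)

lemma surplus_zero_lt_of_x3_lt (h : IsThreePhase P.g P.a P.x0) (hx : P.x3 < x)
    (hp : p ∈ Icc P.a P.x0) : surplus P.g (P.g' x) 0 < surplus P.g (P.g' x) p := by
  have hx3 := h.surplus_zero_le_of_x3_le le_rfl hp
  have hinc := surplus_sub_surplus_lt_of_lt h.strictMono (h.deriv_pos P.x3)
    (h.mono_right h.x0_le_x3 (h.x0_le_x3.trans hx.le) hx) (h.pos_left.trans_le hp.1)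
  exact sub_pos.1 ((sub_nonneg.2 hx3).trans_lt hinc)

lemma ω4_eq (h : IsThreePhase P.g P.a P.x0) (x : ℝ) :
    P.ω4 x = surplus P.g (P.g' x) x - surplus P.g (P.g' x) (P.ω4Start x) := by
  rw [Params.ω4, Params.ω4Start]
  split_ifs <;> exact integral_one_sub_deriv_div h.contDiff _ _ _

lemma ω4Start_mem (h : IsThreePhase P.g P.a P.x0) (hx : P.x0 ≤ x) :
    P.ω4Start x ∈ insert 0 (Icc P.a P.x0) := by
  rw [Params.ω4Start]
  split_ifs with hlt
  · exact Or.inr (h.gInvPlus_mem (h.g'_mem_of_le_x3 hx hlt.le))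
  · exact Or.inl rfl

lemma surplus_ω4Start_le (h : IsThreePhase P.g P.a P.x0) (hx : P.x0 ≤ x)
    (hp : p ∈ insert 0 (Icc P.a P.x0)) :
    surplus P.g (P.g' x) (P.ω4Start x) ≤ surplus P.g (P.g' x) p := by
  rw [Params.ω4Start]
  split_ifs with hlt
  · rcases hp with rfl | hp
    · have hgap := h.startGap_neg_of_lt_x3 hx hlt
      rw [h.startGap_eq] at hgap
      exact (sub_neg.1 hgap).le
    · exact h.surplus_gInvPlus_le (h.g'_mem_of_le_x3 hx hlt.le) hp
  · rcases hp with rfl | hp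
    · exact le_rfl
    · exact h.surplus_zero_le_of_x3_le (not_lt.1 hlt) hp

lemma surplus_sub_le_ω4 (h : IsThreePhase P.g P.a P.x0) (hx : P.x0 ≤ x)
    (hp : p ∈ insert 0 (Icc P.a P.x0)) (hr : P.x0 ≤ r) :
    surplus P.g (P.g' x) r - surplus P.g (P.g' x) p ≤ P.ω4 x := by
  rw [h.ω4_eq]
  exact sub_le_sub (h.surplus_le_right hx hr) (h.surplus_ω4Start_le hx hp)

lemma strictMonoOn_ω4 (h : IsThreePhase P.g P.a P.x0) : StrictMonoOn P.ω4 (Ici P.x0) := by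
  intro x hx y hy hxy
  have hstart : P.ω4Start x ≤ x := by
    rcases h.ω4Start_mem hx with h0 | hmem
    · exact h0.trans_le (h.right_pos.le.trans hx)
    · exact hmem.2.trans hx
  calc P.ω4 x = surplus P.g (P.g' x) x - surplus P.g (P.g' x) (P.ω4Start x) := h.ω4_eq x
    _ ≤ surplus P.g (P.g' y) x - surplus P.g (P.g' y) (P.ω4Start x) :=
      surplus_sub_surplus_le_of_le h.strictMono.monotone (h.deriv_pos x)
        (h.mono_right hx hy hxy).le hstart
    _ < surplus P.g (P.g' y) y - surplus P.g (P.g' y) (P.ω4Start x) :=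
      sub_lt_sub_right (h.surplus_lt_right hy hx hxy.ne) _
    _ ≤ P.ω4 y := h.surplus_sub_le_ω4 hy (h.ω4Start_mem hx) hy

lemma continuousOn_ω4 (h : IsThreePhase P.g P.a P.x0) : ContinuousOn P.ω4 (Ici P.x0) := by
  rw [funext h.ω4_eq]
  exact ((continuous_surplus_deriv h.contDiff h.deriv_pos).comp
      (continuous_id.prodMk continuous_id)).continuousOn.sub
    (continuousOn_surplus_of_isMin h.contDiff h.deriv_pos (isCompact_Icc.insert 0)
      (fun x hx => h.ω4Start_mem hx) fun x hx p hp => h.surplus_ω4Start_le hx hp)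

lemma bijOn_ω4 (h : IsThreePhase P.g P.a P.x0) : BijOn P.ω4 (Ici P.x0) (Ici (P.ω4 P.x0)) := by
  refine bijOn_Ici_of_strictMonoOn h.continuousOn_ω4 h.strictMonoOn_ω4 (tendsto_atTop_mono' _ ?_
    (tendsto_levelGain_atTop h.differentiable h.mono_right h.tendsto_deriv 0))
  filter_upwards [eventually_ge_atTop P.x0] with x hx
  exact h.surplus_sub_le_ω4 hx (mem_insert _ _) hx

lemma surplus_sub_le_of_mem_image_ω4 (h : IsThreePhase P.g P.a P.x0) (hβ : β ∈ P.ω4 '' Ici P.x0)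
    (hp : p ∈ insert 0 (Icc P.a P.x0)) (hr : P.x0 ≤ r) :
    surplus P.g (P.g' (P.ω4Inv β)) r - surplus P.g (P.g' (P.ω4Inv β)) p ≤ β :=
  (h.surplus_sub_le_ω4 (Function.invFunOn_mem hβ) hp hr).trans_eq (Function.invFunOn_eq hβ)

lemma x3_lt_ω4Inv_iff (h : IsThreePhase P.g P.a P.x0) (hβ : β ∈ P.ω4 '' Ici P.x0) :
    P.x3 < P.ω4Inv β ↔ β ∈ P.B3 := by
  rw [Params.ω4Inv, ← h.strictMonoOn_ω4.lt_iff_lt h.x0_le_x3 (Function.invFunOn_mem hβ),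
    Function.invFunOn_eq hβ]
  rfl

lemma mem_image_ω4_of_mem_B3 (h : IsThreePhase P.g P.a P.x0) (hβ : β ∈ P.B3) :
    β ∈ P.ω4 '' Ici P.x0 :=
  h.bijOn_ω4.surjOn ((h.strictMonoOn_ω4.monotoneOn self_mem_Ici h.x0_le_x3 h.x0_le_x3).trans
    (le_of_lt hβ))

lemma surplus_ω4Start_eq (h : IsThreePhase P.g P.a P.x0) (h03 : P.x0 < P.x3) (hx : x ≤ P.x3) :
    surplus P.g (P.g' x) (P.ω4Start x) = surplus P.g (P.g' x) (P.gInvPlus (P.g' x)) := by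
  rcases hx.eq_or_lt with rfl | hlt
  · have hgap : P.startGap P.x3 = 0 :=
      apply_sInf_le_apply_eq h.x0_lt_a7.le h.continuousOn_startGap h.startGap_a7_nonneg h03
    rw [h.startGap_eq, sub_eq_zero] at hgap
    rw [Params.ω4Start, if_neg (lt_irrefl _), hgap]
  · rw [Params.ω4Start, if_pos hlt]

end OmegaFour

section OmegaThree

lemma x0_le_x4 (h : IsThreePhase P.g P.a P.x0) : P.x0 ≤ P.x4 := h.x4_spec.1.1

lemma g'_x4_le (h : IsThreePhase P.g P.a P.x0) : P.g' P.x4 ≤ P.g' P.a :=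
  h.g'_le_g'_a h.x4_spec.1

lemma gInvMinus_x4_mem (h : IsThreePhase P.g P.a P.x0) : P.gInvMinus (P.g' P.x4) ∈ Icc 0 P.a :=
  (h.gInvMinus_spec h.g'_x4_le).1

lemma surplus_x4_le (h : IsThreePhase P.g P.a P.x0) (hy : y ∈ Icc 0 P.a) :
    surplus P.g (P.g' P.x4) y ≤ surplus P.g (P.g' P.x4) P.x4 := by
  have hgap := h.x4_spec.2
  rw [h.stopGap_eq, sub_nonneg] at hgap
  exact (h.surplus_le_gInvMinus (h.deriv_pos _) h.g'_x4_le hy).trans hgap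

lemma x0_lt_x4 (h : IsThreePhase P.g P.a P.x0) : P.x0 < P.x4 := by
  refine h.x0_le_x4.lt_of_ne fun heq => ?_
  have hle := h.surplus_x4_le (right_mem_Icc.2 h.pos_left.le)
  rw [← heq] at hle
  exact hle.not_gt (surplus_lt_surplus_of_strictAntiOn h.differentiable ordConnected_Icc
    h.anti_mid (right_mem_Icc.2 h.left_lt_right.le) (left_mem_Icc.2 h.left_lt_right.le)
    (h.deriv_pos _) h.left_lt_right.ne)

lemma surplus_gInvMinus_x4 (h : IsThreePhase P.g P.a P.x0) :
    surplus P.g (P.g' P.x4) (P.gInvMinus (P.g' P.x4)) = surplus P.g (P.g' P.x4) P.x4 := by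
  have hgap : P.stopGap P.x4 = 0 :=
    apply_sInf_le_apply_eq h.x0_lt_a7.le h.continuousOn_stopGap h.stopGap_a7_nonneg h.x0_lt_x4
  rw [h.stopGap_eq, sub_eq_zero] at hgap
  exact hgap.symm

lemma ω3_eq_levelGain (h : IsThreePhase P.g P.a P.x0) : P.ω3 = levelGain P.g 0 :=
  funext fun x => integral_one_sub_deriv_div h.contDiff (P.g' x) 0 x

lemma ω3_gInvMinus_x4 (h : IsThreePhase P.g P.a P.x0) :
    P.ω3 (P.gInvMinus (P.g' P.x4)) = P.ω3 P.x4 := by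
  have hS := h.surplus_gInvMinus_x4
  rw [h.ω3_eq_levelGain]
  rcases h.gInvMinus_x4_mem.1.eq_or_lt with h0 | hpos
  · rw [← h0] at hS ⊢
    exact (levelGain_self P.g 0).trans (sub_eq_zero.2 hS.symm).symm
  · have hg := h.g'_gInvMinus h.g'_x4_le hpos
    rw [Params.g'] at hg
    rw [levelGain, levelGain, hg]
    exact congrArg (· - _) hS

lemma bijOn_ω3_left (h : IsThreePhase P.g P.a P.x0) :
    BijOn P.ω3 (Icc 0 (P.gInvMinus (P.g' P.x4))) (Icc 0 (P.ω3 P.x4)) := by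
  obtain ⟨h0, ha⟩ := h.gInvMinus_x4_mem
  have hm : StrictMonoOn P.ω3 (Icc 0 (P.gInvMinus (P.g' P.x4))) := h.ω3_eq_levelGain ▸
    strictMonoOn_levelGain h.differentiable h.deriv_pos ordConnected_Icc Icc_subset_Ici_self
      (h.mono_left.mono (Icc_subset_Icc_right ha))
  have hc : Continuous P.ω3 := h.ω3_eq_levelGain ▸ continuous_levelGain h.contDiff h.deriv_pos 0
  have hzero : P.ω3 0 = 0 := h.ω3_eq_levelGain ▸ levelGain_self P.g 0
  have hbij : BijOn P.ω3 (Icc 0 (P.gInvMinus (P.g' P.x4)))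
      (Icc (P.ω3 0) (P.ω3 (P.gInvMinus (P.g' P.x4)))) :=
    ⟨fun x hx => ⟨hm.monotoneOn (left_mem_Icc.2 h0) hx hx.1,
      hm.monotoneOn hx (right_mem_Icc.2 h0) hx.2⟩, hm.injOn,
      intermediate_value_Icc h0 hc.continuousOn⟩
  rwa [hzero, h.ω3_gInvMinus_x4] at hbij

lemma bijOn_ω3_right (h : IsThreePhase P.g P.a P.x0) :
    BijOn P.ω3 (Ici P.x4) (Ici (P.ω3 P.x4)) := by
  rw [h.ω3_eq_levelGain]
  exact h.bijOn_levelGain (h.right_pos.trans h.x0_lt_x4).le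
    (h.mono_right.mono (Ici_subset_Ici.2 h.x0_le_x4))

lemma ω3Inv_nonempty (h : IsThreePhase P.g P.a P.x0) (hβ : 0 ≤ β) : (P.ω3Inv β).Nonempty := by
  rcases le_total β (P.ω3 P.x4) with hle | hle
  · obtain ⟨u, hu, heq⟩ := h.bijOn_ω3_left.surjOn ⟨hβ, hle⟩
    exact ⟨u, Or.inl hu, heq⟩
  · obtain ⟨u, hu, heq⟩ := h.bijOn_ω3_right.surjOn hle
    exact ⟨u, Or.inr hu, heq⟩

lemma subsingleton_ω3Inv (h : IsThreePhase P.g P.a P.x0) (hne : β ≠ P.ω3 P.x4) :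
    (P.ω3Inv β).Subsingleton := by
  have hleft {x : ℝ} (hx : x ∈ Icc 0 (P.gInvMinus (P.g' P.x4))) (heq : P.ω3 x = β) :
      β < P.ω3 P.x4 := ((h.bijOn_ω3_left.mapsTo hx).2.trans_eq' heq).lt_of_ne hne
  have hright {x : ℝ} (hx : x ∈ Ici P.x4) (heq : P.ω3 x = β) : P.ω3 P.x4 < β :=
    ((mem_Ici.1 (h.bijOn_ω3_right.mapsTo hx)).trans_eq heq).lt_of_ne' hne
  rintro x ⟨hx | hx, hxβ⟩ y ⟨hy | hy, hyβ⟩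
  · exact h.bijOn_ω3_left.injOn hx hy (hxβ.trans hyβ.symm)
  · exact absurd (hleft hx hxβ) (hright hy hyβ).not_gt
  · exact absurd (hleft hy hyβ) (hright hx hxβ).not_gt
  · exact h.bijOn_ω3_right.injOn hx hy (hxβ.trans hyβ.symm)

lemma exists_ω3Inv_eq_singleton (h : IsThreePhase P.g P.a P.x0) (hβ : 0 < β)
    (hne : β ≠ P.ω3 P.x4) : ∃ u, P.ω3Inv β = {u} :=
  exists_eq_singleton_iff_nonempty_subsingleton.2 ⟨h.ω3Inv_nonempty hβ.le, h.subsingleton_ω3Inv hne⟩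

lemma ω3Inv_ω3_x4 (h : IsThreePhase P.g P.a P.x0) :
    P.ω3Inv (P.ω3 P.x4) = {P.gInvMinus (P.g' P.x4), P.x4} := by
  have hm := right_mem_Icc.2 h.gInvMinus_x4_mem.1
  refine Subset.antisymm ?_ (insert_subset ⟨Or.inl hm, h.ω3_gInvMinus_x4⟩
    (singleton_subset_iff.2 ⟨Or.inr self_mem_Ici, rfl⟩))
  rintro x ⟨hx | hx, heq⟩
  · exact Or.inl (h.bijOn_ω3_left.injOn hx hm (heq.trans h.ω3_gInvMinus_x4.symm))
  · exact Or.inr (h.bijOn_ω3_right.injOn hx self_mem_Ici heq)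

lemma pos_of_mem_ω3Inv (h : IsThreePhase P.g P.a P.x0) (hβ : 0 < β) (hu : u ∈ P.ω3Inv β) :
    0 < u := by
  rcases hu.1 with hmem | hmem
  · refine hmem.1.lt_of_ne fun h0 => hβ.ne ?_
    rw [← hu.2, ← h0, h.ω3_eq_levelGain, levelGain_self]
  · exact (h.right_pos.trans h.x0_lt_x4).trans_le hmem

lemma g'_gInvMinus_x4 (h : IsThreePhase P.g P.a P.x0) (hpos : 0 < P.ω3 P.x4) :
    P.g' (P.gInvMinus (P.g' P.x4)) = P.g' P.x4 :=
  h.g'_gInvMinus h.g'_x4_le (h.pos_of_mem_ω3Inv hpos (h.ω3Inv_ω3_x4 ▸ mem_insert _ _))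

lemma g'_eq_of_mem_ω3Inv (h : IsThreePhase P.g P.a P.x0) (hβ : 0 < β) (hx : x ∈ P.ω3Inv β)
    (hy : y ∈ P.ω3Inv β) : P.g' x = P.g' y := by
  rcases eq_or_ne β (P.ω3 P.x4) with rfl | hne
  · have hx4 {z : ℝ} (hz : z ∈ P.ω3Inv (P.ω3 P.x4)) : P.g' z = P.g' P.x4 := by
      rw [h.ω3Inv_ω3_x4] at hz
      rcases hz with rfl | rfl
      · exact h.g'_gInvMinus_x4 hβ
      · rfl
    rw [hx4 hx, hx4 hy]
  · rw [h.subsingleton_ω3Inv hne hx hy]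

lemma mem_of_mem_ω3Dom (h : IsThreePhase P.g P.a P.x0) (hx : x ∈ P.ω3Dom) :
    x ∈ Icc 0 P.a ∪ Ici P.x0 :=
  hx.imp (fun hx => ⟨hx.1, hx.2.trans h.gInvMinus_x4_mem.2⟩) h.x0_le_x4.trans

lemma surplus_le_of_mem_left (h : IsThreePhase P.g P.a P.x0) (hpos : 0 < x)
    (hx : x ≤ P.gInvMinus (P.g' P.x4)) (hy : P.x0 ≤ y) :
    surplus P.g (P.g' x) y ≤ surplus P.g (P.g' x) x := by
  obtain ⟨h0, ha⟩ := h.gInvMinus_x4_mem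
  have hlevel : P.g' x ≤ P.g' P.x4 :=
    (h.mono_left.monotoneOn ⟨hpos.le, hx.trans ha⟩ ⟨h0, ha⟩ hx).trans_eq
      (h.g'_gInvMinus h.g'_x4_le (hpos.trans_le hx))
  have hinc := surplus_sub_surplus_le_of_le h.strictMono.monotone (h.deriv_pos x) hlevel
    (ha.trans (h.left_lt_right.le.trans hy))
  have hnonpos := sub_nonpos.2 ((h.surplus_le_right h.x0_le_x4 hy).trans_eq
    h.surplus_gInvMinus_x4.symm)
  exact (sub_nonpos.1 (hinc.trans hnonpos)).trans
    (h.surplus_le_left ⟨hpos.le, hx.trans ha⟩ ⟨h0, ha⟩)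

lemma surplus_le_of_x4_le (h : IsThreePhase P.g P.a P.x0) (hx : P.x4 ≤ x) (hy : y ∈ Icc 0 P.a) :
    surplus P.g (P.g' x) y ≤ surplus P.g (P.g' x) x := by
  have hx0 : P.x0 ≤ x := h.x0_le_x4.trans hx
  have hinc := surplus_sub_surplus_le_of_le h.strictMono.monotone (h.deriv_pos P.x4)
    ((h.g'_le_g'_iff h.x0_le_x4 hx0).2 hx) (hy.2.trans (h.left_lt_right.le.trans h.x0_le_x4))
  exact (sub_nonneg.1 ((sub_nonneg.2 (h.surplus_x4_le hy)).trans hinc)).trans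
    (h.surplus_le_right hx0 h.x0_le_x4)

lemma surplus_le_of_mem_ω3Dom (h : IsThreePhase P.g P.a P.x0) (hx : x ∈ P.ω3Dom) (hpos : 0 < x)
    (hy : y ∈ Icc 0 P.a ∪ Ici P.x0) : surplus P.g (P.g' x) y ≤ surplus P.g (P.g' x) x := by
  rcases hx with hx | hx <;> rcases hy with hy | hy
  · exact h.surplus_le_left ⟨hx.1, hx.2.trans h.gInvMinus_x4_mem.2⟩ hy
  · exact h.surplus_le_of_mem_left hpos hx.2 hy
  · exact h.surplus_le_of_x4_le hx hy
  · exact h.surplus_le_right (h.x0_le_x4.trans hx) hy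

lemma mem_ω3Dom_of_forall_surplus_le (h : IsThreePhase P.g P.a P.x0)
    (hx : x ∈ Icc 0 P.a ∪ Ici P.x0)
    (hmax : ∀ y ∈ Icc 0 P.a ∪ Ici P.x0, surplus P.g (P.g' x) y ≤ surplus P.g (P.g' x) x) :
    x ∈ P.ω3Dom := by
  rcases hx with hx | hx
  · refine Or.inl ⟨hx.1, le_of_not_gt fun hlt => (hmax _ (Or.inr h.x0_le_x4)).not_gt ?_⟩
    have hlevel : P.g' P.x4 < P.g' x := (h.gInvMinus_spec h.g'_x4_le).2.trans_lt
      (h.mono_left h.gInvMinus_x4_mem hx hlt)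
    have hinc := surplus_sub_surplus_lt_of_lt h.strictMono (h.deriv_pos P.x4) hlevel
      (hx.2.trans_lt (h.left_lt_right.trans h.x0_lt_x4))
    exact sub_pos.1 ((sub_nonneg.2 (h.surplus_x4_le hx)).trans_lt hinc)
  · refine Or.inr (mem_Ici.2 (le_of_not_gt fun hlt => ?_))
    have hgap := h.stopGap_neg_of_lt_x4 hx hlt
    rw [h.stopGap_eq, sub_neg] at hgap
    have hx7 : x ∈ Icc P.x0 P.a7 := ⟨hx, hlt.le.trans h.x4_spec.1.2⟩
    exact (hmax _ (Or.inl (h.gInvMinus_spec (h.g'_le_g'_a hx7)).1)).not_gt hgap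

lemma surplus_sub_eq_of_mem_ω3Inv (h : IsThreePhase P.g P.a P.x0) (hu : u ∈ P.ω3Inv β) :
    surplus P.g (P.g' u) u - surplus P.g (P.g' u) 0 = β :=
  (congrFun h.ω3_eq_levelGain u).symm.trans hu.2

lemma surplus_sub_zero_le (h : IsThreePhase P.g P.a P.x0) (hβ : 0 < β) (hu : u ∈ P.ω3Inv β)
    (hv : 0 < v) (hvu : v ≤ P.g' u) (hy : y ∈ Icc 0 P.a ∪ Ici P.x0) :
    surplus P.g v y - surplus P.g v 0 ≤ β :=
  (surplus_sub_surplus_le_of_le h.strictMono.monotone hv hvu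
    (hy.elim (fun hy => hy.1) h.right_pos.le.trans)).trans <|
    (sub_le_sub_right (h.surplus_le_of_mem_ω3Dom hu.1 (h.pos_of_mem_ω3Inv hβ hu) hy) _).trans_eq
      (h.surplus_sub_eq_of_mem_ω3Inv hu)

lemma surplus_sub_zero_lt (h : IsThreePhase P.g P.a P.x0) (hβ : 0 < β) (hu : u ∈ P.ω3Inv β)
    (hv : 0 < v) (hvu : v < P.g' u) (hy : y ∈ Icc 0 P.a ∪ Ici P.x0) :
    surplus P.g v y - surplus P.g v 0 < β :=
  h.surplus_sub_lt_of_lt hβ hv hvu (hy.elim (fun hy => hy.1) h.right_pos.le.trans)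
    (h.surplus_sub_zero_le hβ hu (h.deriv_pos u) le_rfl hy)

end OmegaThree

end IsThreePhase

namespace Params

variable {P : Params} {β x y : ℝ}

lemma mem_wHat_iff : (x, y) ∈ P.wHat β ↔ x = 0 ∧ y ∈ P.ω3Inv β := by
  simp only [Params.wHat, mem_image, Prod.mk.injEq]
  constructor
  · rintro ⟨y', hy', rfl, rfl⟩
    exact ⟨rfl, hy'⟩
  · rintro ⟨rfl, hy⟩
    exact ⟨y, hy, rfl, rfl⟩

lemma mem_image_ω4_of_mem_B2 (h2 : β ∈ P.B2) : β ∈ P.ω4 '' Ici P.x0 := by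
  obtain ⟨-, u, -, himg, -⟩ := h2
  exact himg

end Params

namespace IsThreePhase

variable {P : Params} {β p u v x y : ℝ}

section Maximizers

lemma mem_Mζ_iff_isCandidate (h : IsThreePhase P.g P.a P.x0) (hβ : 0 < β) (hv : 0 < v)
    (hcand : ∀ x y, IsCandidate P.a P.x0 x y → surplus P.g v y - surplus P.g v x ≤ β)
    (hex : ∃ x y, IsCandidate P.a P.x0 x y ∧ surplus P.g v y - surplus P.g v x = β) :
    (x, y) ∈ P.Mζ β ↔ IsCandidate P.a P.x0 x y ∧ surplus P.g v y - surplus P.g v x = β := by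
  obtain ⟨x', y', hxy', heq'⟩ := hex
  rw [Params.mem_Mζ_iff h.toIsSteep hβ hv
    (fun x y hx hxy => h.surplus_sub_le hv hβ.le hcand hx hxy)
    ⟨x', y', h.nonneg_of_isCandidate hxy', h.le_of_isCandidate hxy', heq'⟩]
  constructor
  · rintro ⟨hx, hxy, heq⟩
    exact ⟨h.isCandidate_of_surplus_sub_eq hv hβ hcand hx hxy heq, heq⟩
  · rintro ⟨hxy, heq⟩
    exact ⟨h.nonneg_of_isCandidate hxy, h.le_of_isCandidate hxy, heq⟩

lemma mem_ω3Inv_of_surplus_sub_eq (h : IsThreePhase P.g P.a P.x0)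
    (hmax : ∀ r ∈ Icc 0 P.a ∪ Ici P.x0, surplus P.g (P.g' y) r - surplus P.g (P.g' y) 0 ≤ β)
    (hy : y ∈ Icc 0 P.a ∪ Ici P.x0)
    (heq : surplus P.g (P.g' y) y - surplus P.g (P.g' y) 0 = β) : y ∈ P.ω3Inv β :=
  ⟨h.mem_ω3Dom_of_forall_surplus_le hy fun r hr =>
    (sub_le_sub_iff_right _).1 ((hmax r hr).trans_eq heq.symm),
    (congrFun h.ω3_eq_levelGain y).trans heq⟩

lemma Mζ_eq_wHat (h : IsThreePhase P.g P.a P.x0) (hβ : 0 < β) (hu : u ∈ P.ω3Inv β)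
    (hmid : ∀ p ∈ Icc P.a P.x0, ∀ r, P.x0 ≤ r →
      surplus P.g (P.g' u) r - surplus P.g (P.g' u) p < β) : P.Mζ β = P.wHat β := by
  have hv : 0 < P.g' u := h.deriv_pos u
  have hzero {r : ℝ} (hr : r ∈ Icc 0 P.a ∪ Ici P.x0) :
      surplus P.g (P.g' u) r - surplus P.g (P.g' u) 0 ≤ β :=
    h.surplus_sub_zero_le hβ hu hv le_rfl hr
  have hcand : ∀ x y, IsCandidate P.a P.x0 x y →
      surplus P.g (P.g' u) y - surplus P.g (P.g' u) x ≤ β := by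
    rintro x y (⟨rfl, hy⟩ | ⟨hx, hy⟩)
    · exact hzero hy
    · exact (hmid x hx y hy).le
  have hex {y : ℝ} (hy : y ∈ P.ω3Inv β) : IsCandidate P.a P.x0 0 y ∧
      surplus P.g (P.g' u) y - surplus P.g (P.g' u) 0 = β :=
    ⟨Or.inl ⟨rfl, h.mem_of_mem_ω3Dom hy.1⟩,
      h.g'_eq_of_mem_ω3Inv hβ hy hu ▸ h.surplus_sub_eq_of_mem_ω3Inv hy⟩
  ext ⟨x, y⟩
  rw [h.mem_Mζ_iff_isCandidate hβ hv hcand ⟨0, u, hex hu⟩, Params.mem_wHat_iff]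
  constructor
  · rintro ⟨hxy | ⟨hx, hy⟩, heq⟩
    · obtain ⟨rfl, hy⟩ := id hxy
      have hg : P.g' y = P.g' u :=
        h.deriv_right_eq_of_surplus_sub_eq hv hβ hcand (Or.inl hxy) heq
      rw [← hg] at hzero heq
      exact ⟨rfl, h.mem_ω3Inv_of_surplus_sub_eq (fun r => hzero) hy heq⟩
    · exact absurd heq (hmid x hx y hy).ne
  · rintro ⟨rfl, hy⟩
    exact hex hy

lemma g'_le_g'_ω4Inv_of_mem_B3 (h : IsThreePhase P.g P.a P.x0) (hβ : 0 < β) (h3 : β ∈ P.B3)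
    (hu : u ∈ P.ω3Inv β) : P.g' u ≤ P.g' (P.ω4Inv β) := by
  have himg := h.mem_image_ω4_of_mem_B3 h3
  have hω4 : P.ω4 (P.ω4Inv β) = β := Function.invFunOn_eq himg
  rw [h.ω4_eq, Params.ω4Start, if_neg ((h.x3_lt_ω4Inv_iff himg).2 h3).not_gt] at hω4
  exact le_of_not_gt fun hlt =>
    (h.surplus_sub_zero_lt hβ hu (h.deriv_pos _) hlt (Or.inr (Function.invFunOn_mem himg))).ne hω4

lemma Mζ_eq_wHat_of_g'_lt (h : IsThreePhase P.g P.a P.x0) (hβ : 0 < β) (hu : u ∈ P.ω3Inv β)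
    (hvu : P.g' u < v)
    (hmid : ∀ p ∈ Icc P.a P.x0, ∀ r, P.x0 ≤ r → surplus P.g v r - surplus P.g v p ≤ β) :
    P.Mζ β = P.wHat β :=
  h.Mζ_eq_wHat hβ hu fun p hp r hr => h.surplus_sub_lt_of_lt hβ (h.deriv_pos u) hvu
    (hp.2.trans hr) (hmid p hp r hr)

lemma Mζ_eq_wHat_of_g'_lt_g'_ω4Inv (h : IsThreePhase P.g P.a P.x0) (hβ : 0 < β)
    (hu : u ∈ P.ω3Inv β) (himg : β ∈ P.ω4 '' Ici P.x0) (hlt : P.g' u < P.g' (P.ω4Inv β)) :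
    P.Mζ β = P.wHat β :=
  h.Mζ_eq_wHat_of_g'_lt hβ hu hlt fun _ hp _ hr =>
    h.surplus_sub_le_of_mem_image_ω4 himg (Or.inr hp) hr

lemma Mζ_of_mem_B3 (h : IsThreePhase P.g P.a P.x0) (hβ : 0 < β) (h3 : β ∈ P.B3) :
    P.Mζ β = P.wHat β := by
  obtain ⟨u, hu⟩ := h.ω3Inv_nonempty hβ.le
  have himg := h.mem_image_ω4_of_mem_B3 h3
  rcases (h.g'_le_g'_ω4Inv_of_mem_B3 hβ h3 hu).eq_or_lt with heq | hlt
  · refine h.Mζ_eq_wHat hβ hu fun p hp r hr => ?_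
    have hzero := h.surplus_zero_lt_of_x3_lt ((h.x3_lt_ω4Inv_iff himg).2 h3) hp
    rw [← heq] at hzero
    exact (sub_lt_sub_left hzero _).trans_le
      (h.surplus_sub_zero_le hβ hu (h.deriv_pos u) le_rfl (Or.inr hr))
  · exact h.Mζ_eq_wHat_of_g'_lt_g'_ω4Inv hβ hu himg hlt

lemma ω4_x0_eq_zero_of_x0_lt_x3 (h : IsThreePhase P.g P.a P.x0) (h03 : P.x0 < P.x3) :
    P.ω4 P.x0 = 0 := by
  have hv := h.g'_mem_of_le_x3 le_rfl h.x0_le_x3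
  have hinv : P.gInvPlus (P.g' P.x0) = P.x0 := h.anti_mid.injOn (h.gInvPlus_mem hv)
    (right_mem_Icc.2 h.left_lt_right.le) (h.g'_gInvPlus hv)
  rw [h.ω4_eq, Params.ω4Start, if_pos h03, hinv, sub_self]

lemma g'_lt_g'_x0_of_lt_ω4_x0 (h : IsThreePhase P.g P.a P.x0) (hβ : 0 < β)
    (hlt : β < P.ω4 P.x0) (hu : u ∈ P.ω3Inv β) : P.g' u < P.g' P.x0 := by
  have h30 : P.x3 ≤ P.x0 := le_of_not_gt fun h03 =>
    (hβ.trans hlt).ne' (h.ω4_x0_eq_zero_of_x0_lt_x3 h03)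
  rw [h.ω4_eq, Params.ω4Start, if_neg h30.not_gt] at hlt
  exact lt_of_not_ge fun hle => hlt.not_ge
    (h.surplus_sub_zero_le hβ hu (h.deriv_pos _) hle (Or.inr self_mem_Ici))

lemma surplus_x0_le (h : IsThreePhase P.g P.a P.x0) (hp : p ∈ Icc P.a P.x0) :
    surplus P.g (P.g' P.x0) P.x0 ≤ surplus P.g (P.g' P.x0) p :=
  surplus_le_surplus_of_strictAntiOn h.differentiable ordConnected_Icc h.anti_mid
    (right_mem_Icc.2 h.left_lt_right.le) hp (h.deriv_pos _)

lemma Mζ_of_mem_B1 (h : IsThreePhase P.g P.a P.x0) (h1 : β ∈ P.B1) : P.Mζ β = P.wHat β := by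
  obtain ⟨hβ, u, hu, hlevel⟩ := h1
  by_cases himg : β ∈ P.ω4 '' Ici P.x0
  · exact h.Mζ_eq_wHat_of_g'_lt_g'_ω4Inv hβ hu himg (hlevel.resolve_left (not_not.2 himg))
  · have hlt : β < P.ω4 P.x0 := not_le.1 fun hle => himg (h.bijOn_ω4.surjOn hle)
    exact h.Mζ_eq_wHat_of_g'_lt hβ hu (h.g'_lt_g'_x0_of_lt_ω4_x0 hβ hlt hu) fun p hp r hr =>
      (sub_nonpos.2 ((h.surplus_le_right le_rfl hr).trans (h.surplus_x0_le hp))).trans hβ.le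

lemma x0_lt_x3_of_g'_ω4Inv_le (h : IsThreePhase P.g P.a P.x0) (hβ : 0 < β)
    (himg : β ∈ P.ω4 '' Ici P.x0) (h3 : β ∉ P.B3) (hu : u ∈ P.ω3Inv β)
    (hle : P.g' (P.ω4Inv β) ≤ P.g' u) : P.x0 < P.x3 := by
  refine h.x0_le_x3.lt_of_ne fun h03 => ?_
  have hω4 : P.ω4 (P.ω4Inv β) = β := Function.invFunOn_eq himg
  have hx0 : P.ω4Inv β = P.x0 := ((not_lt.1 ((h.x3_lt_ω4Inv_iff himg).not.2 h3)).trans_eq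
    h03.symm).antisymm (Function.invFunOn_mem himg)
  rw [hx0] at hω4 hle
  rw [h.ω4_eq, Params.ω4Start, if_neg h03.not_lt] at hω4
  have hle_a := h.surplus_sub_zero_le hβ hu (h.deriv_pos _) hle
    (Or.inl (right_mem_Icc.2 h.pos_left.le))
  have hlt_a := surplus_lt_surplus_of_strictAntiOn h.differentiable ordConnected_Icc h.anti_mid
    (right_mem_Icc.2 h.left_lt_right.le) (left_mem_Icc.2 h.left_lt_right.le) (h.deriv_pos _)
    h.left_lt_right.ne
  exact (hω4.symm.trans_lt (sub_lt_sub_right hlt_a _)).not_ge hle_a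

lemma eq_wTilde (h : IsThreePhase P.g P.a P.x0) (himg : β ∈ P.ω4 '' Ici P.x0)
    (hx : x ∈ Icc P.a P.x0) (hy : P.x0 ≤ y) (hgx : P.g' x = P.g' (P.ω4Inv β))
    (hgy : P.g' y = P.g' (P.ω4Inv β)) : (x, y) = P.wTilde β := by
  have hy' : y = P.ω4Inv β := h.mono_right.injOn hy (Function.invFunOn_mem himg) hgy
  have hv := h.bijOn_g'_mid.mapsTo hx
  have hx' : x = P.gInvPlus (P.g' x) :=
    h.anti_mid.injOn hx (h.gInvPlus_mem hv) (h.g'_gInvPlus hv).symm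
  rw [Params.wTilde, ← hgx, ← hx', ← hy']

lemma wTilde_spec (h : IsThreePhase P.g P.a P.x0) (himg : β ∈ P.ω4 '' Ici P.x0) (h3 : β ∉ P.B3)
    (h03 : P.x0 < P.x3) : IsCandidate P.a P.x0 (P.wTilde β).1 (P.wTilde β).2 ∧
      surplus P.g (P.g' (P.ω4Inv β)) (P.wTilde β).2 -
        surplus P.g (P.g' (P.ω4Inv β)) (P.wTilde β).1 = β := by
  have hle : P.ω4Inv β ≤ P.x3 := not_lt.1 ((h.x3_lt_ω4Inv_iff himg).not.2 h3)
  have hmem : P.ω4Inv β ∈ Ici P.x0 := Function.invFunOn_mem himg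
  have hω4 : P.ω4 (P.ω4Inv β) = β := Function.invFunOn_eq himg
  rw [h.ω4_eq, h.surplus_ω4Start_eq h03 hle] at hω4
  exact ⟨Or.inr ⟨h.gInvPlus_mem (h.g'_mem_of_le_x3 hmem hle), hmem⟩, hω4⟩

lemma mem_Mζ_iff_of_g'_ω4Inv_le (h : IsThreePhase P.g P.a P.x0) (hβ : 0 < β)
    (himg : β ∈ P.ω4 '' Ici P.x0) (h3 : β ∉ P.B3) (hu : u ∈ P.ω3Inv β)
    (hle : P.g' (P.ω4Inv β) ≤ P.g' u) :
    (x, y) ∈ P.Mζ β ↔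
      (x, y) = P.wTilde β ∨ ((x, y) ∈ P.wHat β ∧ P.g' y = P.g' (P.ω4Inv β)) := by
  have hv : 0 < P.g' (P.ω4Inv β) := h.deriv_pos _
  have hzero {r : ℝ} (hr : r ∈ Icc 0 P.a ∪ Ici P.x0) :
      surplus P.g (P.g' (P.ω4Inv β)) r - surplus P.g (P.g' (P.ω4Inv β)) 0 ≤ β :=
    h.surplus_sub_zero_le hβ hu hv hle hr
  have hcand : ∀ x y, IsCandidate P.a P.x0 x y →
      surplus P.g (P.g' (P.ω4Inv β)) y - surplus P.g (P.g' (P.ω4Inv β)) x ≤ β := by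
    rintro x y (⟨rfl, hy⟩ | ⟨hx, hy⟩)
    · exact hzero hy
    · exact h.surplus_sub_le_of_mem_image_ω4 himg (Or.inr hx) hy
  have hw := h.wTilde_spec himg h3 (h.x0_lt_x3_of_g'_ω4Inv_le hβ himg h3 hu hle)
  rw [h.mem_Mζ_iff_isCandidate hβ hv hcand ⟨_, _, hw⟩, Params.mem_wHat_iff]
  constructor
  · rintro ⟨hxy, heq⟩
    have hg : P.g' y = P.g' (P.ω4Inv β) := h.deriv_right_eq_of_surplus_sub_eq hv hβ hcand hxy heq
    rcases hxy with ⟨rfl, hy⟩ | ⟨hx, hy⟩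
    · rw [← hg] at hzero heq
      exact Or.inr ⟨⟨rfl, h.mem_ω3Inv_of_surplus_sub_eq (fun r => hzero) hy heq⟩, hg⟩
    · exact Or.inl (h.eq_wTilde himg hx hy
        (h.deriv_left_eq_of_surplus_sub_eq hv hβ hcand hx hy heq) hg)
  · rintro (heq | ⟨⟨rfl, hy⟩, hg⟩)
    · obtain ⟨rfl, rfl⟩ := Prod.ext_iff.1 heq
      exact hw
    · exact ⟨Or.inl ⟨rfl, h.mem_of_mem_ω3Dom hy.1⟩, hg ▸ h.surplus_sub_eq_of_mem_ω3Inv hy⟩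

lemma Mζ_of_mem_B2 (h : IsThreePhase P.g P.a P.x0) (h2 : β ∈ P.B2) (h3 : β ∉ P.B3) :
    P.Mζ β = {P.wTilde β} := by
  obtain ⟨hβ, u, hu, himg, hlt⟩ := h2
  ext ⟨x, y⟩
  rw [h.mem_Mζ_iff_of_g'_ω4Inv_le hβ himg h3 hu hlt.le, mem_singleton_iff, or_iff_left]
  rintro ⟨hxy, hg⟩
  exact hlt.ne' ((h.g'_eq_of_mem_ω3Inv hβ hu (Params.mem_wHat_iff.1 hxy).2).trans hg)

lemma mem_image_ω4_of_notMem_B1 (h : IsThreePhase P.g P.a P.x0) (hβ : 0 < β) (h1 : β ∉ P.B1) :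
    β ∈ P.ω4 '' Ici P.x0 := by
  obtain ⟨u, hu⟩ := h.ω3Inv_nonempty hβ.le
  exact of_not_not fun himg => h1 ⟨hβ, u, hu, Or.inl himg⟩

lemma Mζ_of_notMem (h : IsThreePhase P.g P.a P.x0) (hβ : 0 < β)
    (hn : β ∉ P.B1 ∪ P.B2 ∪ P.B3) : P.Mζ β = P.wHat β ∪ {P.wTilde β} := by
  obtain ⟨⟨h1, h2⟩, h3⟩ : (β ∉ P.B1 ∧ β ∉ P.B2) ∧ β ∉ P.B3 := by
    simpa only [mem_union, not_or] using hn
  have himg := h.mem_image_ω4_of_notMem_B1 hβ h1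
  obtain ⟨u, hu⟩ := h.ω3Inv_nonempty hβ.le
  have hlevel : P.g' u = P.g' (P.ω4Inv β) :=
    le_antisymm (not_lt.1 fun hlt => h2 ⟨hβ, u, hu, himg, hlt⟩)
      (not_lt.1 fun hlt => h1 ⟨hβ, u, hu, Or.inr hlt⟩)
  ext ⟨x, y⟩
  rw [h.mem_Mζ_iff_of_g'_ω4Inv_le hβ himg h3 hu hlevel.ge, or_comm, mem_union, mem_singleton_iff,
    and_iff_left_of_imp]
  exact fun hxy => (h.g'_eq_of_mem_ω3Inv hβ (Params.mem_wHat_iff.1 hxy).2 hu).trans hlevel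

lemma B2_inter_B3 (h : IsThreePhase P.g P.a P.x0) : P.B2 ∩ P.B3 = ∅ := by
  refine eq_empty_iff_forall_notMem.2 ?_
  rintro β ⟨⟨hβ, u, hu, -, hlt⟩, h3⟩
  exact hlt.not_ge (h.g'_le_g'_ω4Inv_of_mem_B3 hβ h3 hu)

end Maximizers

end IsThreePhase

end ImpulseDividend

theorem mainTheorem4 (P : ImpulseDividend.Params)
    (ha : 0 < P.a) (hσp : 0 < P.σp) (hσm : 0 < P.σm) (hq : 0 < P.q)
    (hμp : 0 < P.μp) (hμm : P.μm ≤ 0) :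
    -- Case (i): the inverse of `φ₀` is well defined, and `M_ζ` is a singleton
    (P.CaseI →
      Set.BijOn P.φ0 (Set.Ici 0) (Set.Ici 0) ∧
      ∀ β : ℝ, 0 < β → P.Mζ β = {(0, P.φ0Inv β)}) ∧
    (P.CaseII →
      -- well-definedness of the inverse functions
      Set.BijOn P.g' (Set.Icc P.a P.x0) (Set.Icc (P.g' P.x0) (P.g' P.a7)) ∧
      Set.BijOn P.ω4 (Set.Ici P.x0) (Set.Ici (P.ω4 P.x0)) ∧
      (∀ β : ℝ, 0 < β → β ≠ P.ω3 P.x4 → ∃ u, P.ω3Inv β = {u}) ∧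
      (∀ β : ℝ, 0 < β → β = P.ω3 P.x4 →
        P.ω3Inv β = {P.gInvMinus (P.g' P.x4), P.x4} ∧
        P.g' (P.gInvMinus (P.g' P.x4)) = P.g' P.x4) ∧
      -- the description of `M_ζ`
      (∀ β : ℝ, 0 < β →
        (β ∈ P.B1 ∪ P.B3 → P.Mζ β = P.wHat β) ∧
        (β ∈ P.B2 ∩ (Set.Ioi 0 \ P.B3) →
          β ∈ P.ω4 '' Set.Ici P.x0 ∧ P.Mζ β = {P.wTilde β}) ∧
        (β ∈ Set.Ioi 0 \ (P.B1 ∪ P.B2 ∪ P.B3) →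
          β ∈ P.ω4 '' Set.Ici P.x0 ∧ P.Mζ β = P.wHat β ∪ {P.wTilde β})) ∧
      P.B2 ∩ P.B3 = ∅) := by
  have h : P.Admissible := ⟨ha, hσp, hσm, hq, hμp, hμm⟩
  refine ⟨fun hc => ?_, fun hc => ?_⟩
  · have hm := h.strictMonoOn_g'_of_caseI hc
    exact ⟨ImpulseDividend.Params.bijOn_φ0 h.isSteep hm,
      fun β hβ => ImpulseDividend.Params.Mζ_eq_of_strictMonoOn h.isSteep hm hβ⟩
  · have h3 := h.isThreePhase_of_caseII hc
    refine ⟨h3.bijOn_g'_mid, h3.bijOn_ω4, fun β hβ => h3.exists_ω3Inv_eq_singleton hβ, ?_,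
      fun β hβ => ⟨?_, ?_, ?_⟩, h3.B2_inter_B3⟩
    · rintro β hβ rfl
      exact ⟨h3.ω3Inv_ω3_x4, h3.g'_gInvMinus_x4 hβ⟩
    · rintro (hB1 | hB3)
      exacts [h3.Mζ_of_mem_B1 hB1, h3.Mζ_of_mem_B3 hβ hB3]
    · rintro ⟨hB2, -, hB3⟩
      exact ⟨ImpulseDividend.Params.mem_image_ω4_of_mem_B2 hB2, h3.Mζ_of_mem_B2 hB2 hB3⟩
    · rintro ⟨-, hB⟩
      exact ⟨h3.mem_image_ω4_of_notMem_B1 hβ fun hB1 => hB (Or.inl (Or.inl hB1)),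
        h3.Mζ_of_notMem hβ hB⟩
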